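/- Let $r,s\ge 0$ be integers, $N=r+s$, and let $X=[x_{i,j}]_{1\le i,j\le N}$ be a matrix of indeterminates. Over the field $\mathbb{C}(X)$ of rational functions in the $x_{i,j}$, let $X=X_-X_0X_+$ be the Gauss decomposition of $X$ into a lower unitriangular, a diagonal and an upper unitriangular matrix. For $0\le k\le N$ and a partition $\nu$ contained in the rectangle $((N-k)^k)$, that is, with at most $k$ parts and $\nu_1\le N-k$, let $S^{(k)}_\nu(X)\in\mathbb{C}(X)$ be the minor of $X_+$ with rows $1,\dots,k$ and columns $\nu_{k}+1<\nu_{k-1}+2<\cdots<\nu_1+k$ (the ninth variation of the Schur function). Let $\lambda$ be a partition contained in $(s^r)$, with conjugate $\lambda'$. A corner of $\lambda$ is a cell $(i,j)$ of its Young diagram $D(\lambda)$ with $(i+1,j),(i,j+1)\notin D(\lambda)$. Suppose $\lambda$ has $n$ corners $(r_1,m_1),\dots,(r_n,m_n)$, with $r_1<\cdots<r_n$ and $m_1>\cdots>m_n$, and put $m_{n+1}=0$. The outside border of a partition $\nu$ is the set of the cells not in $D(\nu)$ that lie immediately below, to the right of, or diagonally below and to the right of a cell of $D(\nu)$; the inside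 border is the set of the cells $(i,j)\in D(\nu)$ with $(i+1,j+1)\notin D(\nu)$. For cells $u,v$ of the outside border of $\nu$, $\mathrm{add}^u_v(\nu)$ is the partition whose diagram is obtained from $D(\nu)$ by adding the part of the outside border that runs (downwards and to the left) from $u$ to $v$, if the result is a Young diagram; for $u,v$ on the inside border, $\mathrm{rem}^u_v(\nu)$ is the partition obtained by removing the part of the inside border from $u$ to $v$, if the result is a Young diagram. For $1\le p\le q\le n$ put $$\mathrm{add}^p_q=\mathrm{add}^{(r_p+1,\,m_p)}_{(r_q+1,\,m_{q+1}+1)},\qquad \mathrm{rem}^p_q=\mathrm{rem}^{(r_p,\,m_p)}_{(r_q,\,m_{q+1}+1)},$$ and for $1\le p_1<\cdots<p_t\le q_t<\cdots<q_1\le n$ put $$\mathrm{add}^{p_1,\dots,p_t}_{q_1,\dots,q_t}(\lambda)=\mathrm{add}^{p_1}_{q_1}\circ\cdots\circ\mathrm{add}^{p_t}_{q_t}(\lambda),\qquad \mathrm{rem}^{p_1,\dots,p_t}_{q_1,\dots,q_t}(\lambda)=\mathrm{rem}^{p_1}_{q_1}\circ\cdots\circ\mathrm{rem}^{p_t}_{q_t}(\lambda),$$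 where the numbers $r_p,m_p$ are always those of the original $\lambda$. The same notation is used with $\lambda'$ in place of $\lambda$, then with the corners of $\lambda'$. Finally, $\nu\pm(1^\ell)$ is obtained from $\nu$ by replacing $\nu_i$ by $\nu_i\pm 1$ for $1\le i\le\ell$ (zero parts being dropped). Let $1\le d\le n$. (1) Assume that $\lambda$ has at most $r-1$ parts, so that $S^{(r-1)}_\lambda(X)$ is defined, and let $\ell$ be the $d$-th smallest element of the set of heights of columns of $\lambda$. Then $$S^{(r)}_\lambda(X)S^{(r-1)}_\lambda(X)=S^{(r)}_{\lambda-(1^\ell)}(X)S^{(r-1)}_{\lambda+(1^\ell)}(X)+\sum_{t=1}^{\min\{d,n-d+1\}}(-1)^{t-1}\sum_{\substack{1\le p_1<\cdots<p_t\le d\\ d\le q_t<\cdots<q_1\le n}}S^{(r)}_{\mathrm{add}^{p_1,\dots,p_t}_{q_1,\dots,q_t}(\lambda)}(X)\,S^{(r-1)}_{\mathrm{rem}^{p_1,\dots,p_t}_{q_1,\dots,q_t}(\lambda)}(X).$$ (2) Assume that $\lambda_1\le s-1$, so that $S^{(r+1)}_\lambda(X)$ is defined, and let $\ell$ be the $d$-th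 smallest element of the set of lengths of rows of $\lambda$. Then $$S^{(r)}_\lambda(X)S^{(r+1)}_\lambda(X)=S^{(r)}_{(\lambda'-(1^\ell))'}(X)S^{(r+1)}_{(\lambda'+(1^\ell))'}(X)+\sum_{t=1}^{\min\{d,n-d+1\}}(-1)^{t-1}\sum_{\substack{1\le p_1<\cdots<p_t\le d\\ d\le q_t<\cdots<q_1\le n}}S^{(r)}_{(\mathrm{add}^{p_1,\dots,p_t}_{q_1,\dots,q_t}(\lambda'))'}(X)\,S^{(r+1)}_{(\mathrm{rem}^{p_1,\dots,p_t}_{q_1,\dots,q_t}(\lambda'))'}(X).$$ -/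

import Mathlib

open Finset

/-! ### Gauss decomposition of the generic matrix -/

/-- `A = L * D * U` with `L` lower unitriangular, `D` diagonal and `U` upper unitriangular. -/
structure IsGaussDecomposition {n : ℕ} {K : Type*} [Field K]
    (A L D U : Matrix (Fin n) (Fin n) K) : Prop where
  lower_zero : ∀ i j, i < j → L i j = 0
  lower_one : ∀ i, L i i = 1
  diag : D.IsDiag
  upper_zero : ∀ i j, j < i → U i j = 0
  upper_one : ∀ i, U i i = 1
  eq : A = L * D * U

theorem exists_isGaussDecomposition {K : Type*} [Field K] :
    ∀ (n : ℕ) (A : Matrix (Fin n) (Fin n) K),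
      (∀ (k : ℕ) (hk : k ≤ n), (A.submatrix (Fin.castLE hk) (Fin.castLE hk)).det ≠ 0) →
      ∃ L D U, IsGaussDecomposition A L D U := by
  intro n
  induction n with
  | zero =>
    intro A _
    exact ⟨1, 1, 1, fun i => i.elim0, fun i => i.elim0, fun i => i.elim0, fun i => i.elim0,
      fun i => i.elim0, by ext i; exact i.elim0⟩
  | succ n ih =>
    intro A hA
    obtain ⟨L, D, U, h⟩ := ih (A.submatrix Fin.castSucc Fin.castSucc) (by
      intro k hk
      exact hA k (hk.trans n.le_succ))
    have hdet : (L * D * U).det ≠ 0 := by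
      rw [← h.eq]
      exact hA n n.le_succ
    have hLD : IsUnit (L * D).det := by
      rw [Matrix.det_mul] at hdet
      exact isUnit_iff_ne_zero.2 (left_ne_zero_of_mul hdet)
    have hDU : IsUnit (D * U).det := by
      rw [Matrix.mul_assoc, Matrix.det_mul] at hdet
      exact isUnit_iff_ne_zero.2 (right_ne_zero_of_mul hdet)
    obtain ⟨u, hu⟩ : ∃ u : Fin n → K,
        (L * D).mulVec u = fun i => A (Fin.castSucc i) (Fin.last n) :=
      ⟨(L * D)⁻¹.mulVec _, by
        rw [Matrix.mulVec_mulVec, Matrix.mul_nonsing_inv _ hLD, Matrix.one_mulVec]⟩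
    obtain ⟨l, hl⟩ : ∃ l : Fin n → K,
        Matrix.vecMul l (D * U) = fun j => A (Fin.last n) (Fin.castSucc j) :=
      ⟨Matrix.vecMul _ (D * U)⁻¹, by
        rw [Matrix.vecMul_vecMul, Matrix.nonsing_inv_mul _ hDU, Matrix.vecMul_one]⟩
    have key : ∀ i j, A (Fin.castSucc i) (Fin.castSucc j) = ∑ x, (∑ y, L i y * D y x) * U x j := by
      intro i j
      have := congrFun (congrFun h.eq i) j
      simpa [Matrix.mul_apply] using this
    refine ⟨Matrix.of (Fin.lastCases (Fin.lastCases 1 l) fun i => Fin.lastCases 0 (L i)),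
      Matrix.of (Fin.lastCases
        (Fin.lastCases (A (Fin.last n) (Fin.last n) - ∑ x, (∑ y, l y * D y x) * u x) 0)
        fun i => Fin.lastCases 0 (D i)),
      Matrix.of (Fin.lastCases (Fin.lastCases 1 0) fun i => Fin.lastCases (u i) (U i)),
      ?_, ?_, ?_, ?_, ?_, ?_⟩
    · intro i j
      refine Fin.lastCases ?_ (fun j => ?_) j <;> refine Fin.lastCases ?_ (fun i => ?_) i
      · simp
      · simp
      · simp [Fin.le_last, not_lt]
      · intro hij
        simpa using h.lower_zero i j (by simpa using hij)
    · intro i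
      refine Fin.lastCases ?_ (fun i => ?_) i
      · simp
      · simpa using h.lower_one i
    · intro i j
      refine Fin.lastCases ?_ (fun j => ?_) j <;> refine Fin.lastCases ?_ (fun i => ?_) i
      · simp
      · simp
      · simp
      · intro hij
        simpa using h.diag (show i ≠ j from fun e => hij (by rw [e]))
    · intro i j
      refine Fin.lastCases ?_ (fun j => ?_) j <;> refine Fin.lastCases ?_ (fun i => ?_) i
      · simp
      · simp [Fin.le_last, not_lt]
      · simp
      · intro hij
        simpa using h.upper_zero i j (by simpa using hij)
    · intro i
      refine Fin.lastCases ?_ (fun i => ?_) i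
      · simp
      · simpa using h.upper_one i
    · ext i j
      refine Fin.lastCases ?_ (fun j => ?_) j <;> refine Fin.lastCases ?_ (fun i => ?_) i
      · simp [Matrix.mul_apply, Fin.sum_univ_castSucc]
      · have := congrFun hu i
        simp only [Matrix.mulVec, dotProduct, Matrix.mul_apply] at this
        simp [Matrix.mul_apply, Fin.sum_univ_castSucc, ← this]
      · have := congrFun hl j
        rw [← Matrix.vecMul_vecMul] at this
        simp only [Matrix.vecMul, dotProduct] at this
        simp [Matrix.mul_apply, Fin.sum_univ_castSucc, ← this]
      · simp [Matrix.mul_apply, Fin.sum_univ_castSucc, key]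

/-- The upper unitriangular factor of an invertible matrix is unique. -/
theorem IsGaussDecomposition.upper_unique {n : ℕ} {K : Type*} [Field K]
    {A L D U L' D' U' : Matrix (Fin n) (Fin n) K} (hA : A.det ≠ 0)
    (h : IsGaussDecomposition A L D U) (h' : IsGaussDecomposition A L' D' U') : U = U' := by
  have e : L * D * U = L' * D' * U' := h.eq.symm.trans h'.eq
  have hd : (L * D * U).det ≠ 0 := by rw [← h.eq]; exact hA
  have hd' : (L' * D' * U').det ≠ 0 := by rw [← h'.eq]; exact hA
  simp only [Matrix.det_mul, mul_ne_zero_iff] at hd hd'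
  obtain ⟨⟨hL, hD⟩, hU⟩ := hd
  obtain ⟨⟨hL', hD'⟩, hU'⟩ := hd'
  have uL : IsUnit L'.det := isUnit_iff_ne_zero.2 hL'
  have uU : IsUnit U.det := isUnit_iff_ne_zero.2 hU
  have tL : L.BlockTriangular OrderDual.toDual := fun i j hij => h.lower_zero i j hij
  have tL' : L'.BlockTriangular OrderDual.toDual := fun i j hij => h'.lower_zero i j hij
  have tU : U.BlockTriangular id := fun i j hij => h.upper_zero i j hij
  have tU' : U'.BlockTriangular id := fun i j hij => h'.upper_zero i j hij
  let _ := Matrix.invertibleOfIsUnitDet L' uL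
  let _ := Matrix.invertibleOfIsUnitDet U uU
  have tD : D.BlockTriangular OrderDual.toDual := fun i j hij => h.diag (ne_of_lt hij)
  have tLi := (Matrix.blockTriangular_inv_of_blockTriangular tL').mul (tL.mul tD)
  have tUi := tU'.mul (Matrix.blockTriangular_inv_of_blockTriangular tU)
  have e2 : L'⁻¹ * (L * D) = D' * (U' * U⁻¹) := by
    have : L'⁻¹ * (L * D * U) * U⁻¹ = L'⁻¹ * (L' * D' * U') * U⁻¹ := by rw [e]
    rw [Matrix.mul_assoc L'⁻¹, Matrix.mul_assoc (L * D), Matrix.mul_nonsing_inv _ uU,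
      Matrix.mul_one] at this
    rw [this]
    simp only [← Matrix.mul_assoc]
    rw [Matrix.nonsing_inv_mul _ uL, Matrix.one_mul]
  set V := U' * U⁻¹ with hV
  have eU : V * U = U' := by
    rw [hV, Matrix.mul_assoc, Matrix.nonsing_inv_mul _ uU, Matrix.mul_one]
  have hDd : ∀ i, D' i i ≠ 0 := by
    intro i hi
    apply hD'
    rw [← h'.diag.diagonal_diag, Matrix.det_diagonal]
    exact Finset.prod_eq_zero (Finset.mem_univ i) hi
  have hoff : ∀ i j, i ≠ j → V i j = 0 := by
    intro i j hij
    rcases lt_or_gt_of_ne hij with hlt | hgt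
    · have h0 : (L'⁻¹ * (L * D)) i j = 0 := tLi hlt
      rw [e2, ← h'.diag.diagonal_diag, Matrix.diagonal_mul] at h0
      exact (mul_eq_zero.1 h0).resolve_left (hDd i)
    · exact tUi hgt
  have hdiag : ∀ i, V i i = 1 := by
    intro i
    have := congrFun (congrFun eU i) i
    rw [Matrix.mul_apply, Finset.sum_eq_single i (fun j _ hj => by rw [hoff i j hj.symm, zero_mul])
      (by simp), h.upper_one, h'.upper_one, mul_one] at this
    exact this
  have : V = 1 := by
    ext i j
    by_cases hij : i = j
    · subst hij; rw [hdiag, Matrix.one_apply_eq]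
    · rw [hoff i j hij, Matrix.one_apply_ne hij]
  rw [← eU, this, Matrix.one_mul]

/-- The field `ℂ(X)` of rational functions in the variables `x i j`, `i, j : Fin N`. -/
abbrev RatField (N : ℕ) : Type := FractionRing (MvPolynomial (Fin N × Fin N) ℂ)

/-- The generic `N × N` matrix `X = (x i j)`, with entries in `ℂ(X)`. -/
noncomputable def genericMatrix (N : ℕ) : Matrix (Fin N) (Fin N) (RatField N) :=
  (Matrix.mvPolynomialX (Fin N) (Fin N) ℂ).map (algebraMap _ (RatField N))

theorem genericMatrix_minor_ne_zero (N k : ℕ) (hk : k ≤ N) :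
    ((genericMatrix N).submatrix (Fin.castLE hk) (Fin.castLE hk)).det ≠ 0 := by
  have hP : ((Matrix.mvPolynomialX (Fin N) (Fin N) ℂ).submatrix
      (Fin.castLE hk) (Fin.castLE hk)).det ≠ 0 := by
    intro h0
    have h1 := congrArg (MvPolynomial.eval fun p : Fin N × Fin N => (1 : Matrix _ _ ℂ) p.1 p.2) h0
    rw [RingHom.map_det, map_zero] at h1
    have h2 : (MvPolynomial.eval fun p : Fin N × Fin N => (1 : Matrix _ _ ℂ) p.1 p.2).mapMatrix
        ((Matrix.mvPolynomialX (Fin N) (Fin N) ℂ).submatrix (Fin.castLE hk) (Fin.castLE hk))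
        = 1 := by
      ext i j
      simp [Matrix.one_apply, Fin.ext_iff]
    rw [h2, Matrix.det_one] at h1
    exact one_ne_zero h1
  intro h0
  apply hP
  apply IsFractionRing.injective (MvPolynomial (Fin N × Fin N) ℂ) (RatField N)
  rw [RingHom.map_det, map_zero, ← h0]
  rfl

theorem exists_gaussUpper (N : ℕ) :
    ∃! U, ∃ L D, IsGaussDecomposition (genericMatrix N) L D U := by
  obtain ⟨L, D, U, h⟩ := exists_isGaussDecomposition N (genericMatrix N)
    (genericMatrix_minor_ne_zero N)
  refine ⟨U, ⟨L, D, h⟩, ?_⟩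
  rintro U' ⟨L', D', h'⟩
  exact h'.upper_unique (genericMatrix_minor_ne_zero N N le_rfl) h

/-- The upper unitriangular factor `X₊` in the Gauss decomposition `X = X₋ X₀ X₊` of the
generic `N × N` matrix. -/
noncomputable def gaussUpper (N : ℕ) : Matrix (Fin N) (Fin N) (RatField N) :=
  (exists_gaussUpper N).choose

/-! ### Ninth variations of skew Schur functions -/

/-- The `a`-th element (with `a` and the elements counted from `0`) of the Maya diagram
`{λ_{r+1-a} + a | 1 ≤ a ≤ r}` of `lam`. -/
def maya (r : ℕ) (lam : YoungDiagram) (a : Fin r) : ℕ := lam.rowLen a.rev + a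

/-- The entries of a square matrix, read at natural-number positions (and `0` outside it). -/
def entry {N : ℕ} {K : Type*} [Zero K] (M : Matrix (Fin N) (Fin N) K) (i j : ℕ) : K :=
  if h : i < N ∧ j < N then M ⟨i, h.1⟩ ⟨j, h.2⟩ else 0

/-- The ninth variation `S^{(r)}_{λ/μ}(X)` for the generic `N × N` matrix `X`, meaningful for
`μ ⊆ λ` and `λ` inside the rectangle with `r` rows and `N - r` columns: the minor of `X₊` with rows
the Maya diagram of `μ` and columns the Maya diagram of `λ`. -/
noncomputable def ninthSkewSchur (N r : ℕ) (lam mu : YoungDiagram) : RatField N :=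
  (Matrix.of fun a b : Fin r => entry (gaussUpper N) (maya r mu a) (maya r lam b)).det

/-- `S^{(r)}_λ(X) = S^{(r)}_{λ/∅}(X)`. -/
noncomputable def ninthSchur (N r : ℕ) (lam : YoungDiagram) : RatField N :=
  ninthSkewSchur N r lam ⊥

/-! ### Operations on Young diagrams

Cells are counted from `0`: the cell in row `i` and column `j` of the usual convention is
`(i - 1, j - 1)`. -/

open Classical in
/-- The Young diagram with the given set of cells, if this set is a Young diagram (otherwise the
empty diagram, as a default value). -/
noncomputable def diagramOfCells (s : Finset (ℕ × ℕ)) : YoungDiagram :=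
  if h : IsLowerSet (s : Set (ℕ × ℕ)) then ⟨s, h⟩ else ⊥

/-- `λ + (1^ℓ)`: one more cell in each of the first `ℓ` rows. -/
noncomputable def addColumn (lam : YoungDiagram) (l : ℕ) : YoungDiagram :=
  diagramOfCells (lam.cells ∪ (range l).image fun i => (i, lam.rowLen i))

/-- `λ - (1^ℓ)`: one cell less (the last one) in each of the first `ℓ` rows. -/
noncomputable def removeColumn (lam : YoungDiagram) (l : ℕ) : YoungDiagram :=
  diagramOfCells (lam.cells.filter fun c => ¬(c.1 < l ∧ c.2 + 1 = lam.rowLen c.1))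

/-- The outside border of `lam`: the cells not in `lam` which are immediately below, to the right
of, or diagonally below and to the right of a cell of `lam`. -/
def outsideBorder (lam : YoungDiagram) : Set (ℕ × ℕ) :=
  {c | c ∉ lam ∧ ∃ b ∈ lam, c = (b.1 + 1, b.2) ∨ c = (b.1, b.2 + 1) ∨ c = (b.1 + 1, b.2 + 1)}

/-- The inside border of `lam`: the cells `(i, j)` of `lam` with `(i + 1, j + 1)` not in `lam`. -/
def insideBorder (lam : YoungDiagram) : Set (ℕ × ℕ) :=
  {c | c ∈ lam ∧ (c.1 + 1, c.2 + 1) ∉ lam}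

open Classical in
/-- The cells of a strip `B` (running from the upper right to the lower left) from its cell `u` to
its cell `v`. -/
noncomputable def substrip (B : Set (ℕ × ℕ)) (u v : ℕ × ℕ) : Finset (ℕ × ℕ) :=
  (Icc u.1 v.1 ×ˢ Icc v.2 u.2).filter (· ∈ B)

open Classical in
/-- `add^u_v(λ)` for `u`, `v` on the outside border of `λ`. -/
noncomputable def addStrip (u v : ℕ × ℕ) (lam : YoungDiagram) : YoungDiagram :=
  if u ∈ outsideBorder lam ∧ v ∈ outsideBorder lam then
    diagramOfCells (lam.cells ∪ substrip (outsideBorder lam) u v) else ⊥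

open Classical in
/-- `rem^u_v(λ)` for `u`, `v` on the inside border of `λ`. -/
noncomputable def remStrip (u v : ℕ × ℕ) (lam : YoungDiagram) : YoungDiagram :=
  if u ∈ insideBorder lam ∧ v ∈ insideBorder lam then
    diagramOfCells (lam.cells \ substrip (insideBorder lam) u v) else ⊥

/-- The set `C(λ)` of corners of `λ`. -/
def corners (lam : YoungDiagram) : Finset (ℕ × ℕ) :=
  lam.cells.filter fun c => (c.1 + 1, c.2) ∉ lam ∧ (c.1, c.2 + 1) ∉ lam

/-- The `k`-th smallest element of `s` (for `1 ≤ k ≤ #s`). -/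
noncomputable def kthSmallest (s : Finset ℕ) (k : ℕ) : ℕ := Nat.nth (· ∈ s) (k - 1)

/-- The row index `r_p` (counted from `1`) of the `p`-th corner of `λ` from the top, for
`1 ≤ p ≤ #C(λ)`. -/
noncomputable def cornerRow (lam : YoungDiagram) (p : ℕ) : ℕ :=
  kthSmallest ((corners lam).image fun c => c.1 + 1) p

/-- The column index `m_p` (counted from `1`) of the `p`-th corner of `λ` from the top, that is,
the length of row `r_p`, for `1 ≤ p ≤ n = #C(λ)`; and `m_{n+1} = 0`. -/
noncomputable def cornerCol (lam : YoungDiagram) (p : ℕ) : ℕ :=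
  if p ≤ #(corners lam) then lam.rowLen (cornerRow lam p - 1) else 0

/-- The operator `add^p_q` attached to `λ`, applied to `ν`: it adds the strip from
`(r_p + 1, m_p)` to `(r_q + 1, m_{q+1} + 1)`, these numbers being those of `λ`. -/
noncomputable def addOp (lam : YoungDiagram) (p q : ℕ) (nu : YoungDiagram) : YoungDiagram :=
  addStrip (cornerRow lam p, cornerCol lam p - 1) (cornerRow lam q, cornerCol lam (q + 1)) nu

/-- The operator `rem^p_q` attached to `λ`, applied to `ν`: it removes the strip from
`(r_p, m_p)` to `(r_q, m_{q+1} + 1)`, these numbers being those of `λ`. -/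
noncomputable def remOp (lam : YoungDiagram) (p q : ℕ) (nu : YoungDiagram) : YoungDiagram :=
  remStrip (cornerRow lam p - 1, cornerCol lam p - 1)
    (cornerRow lam q - 1, cornerCol lam (q + 1)) nu

/-- The pairs `(p_1, q_1), …, (p_t, q_t)`, where `P = {p_1 < ⋯ < p_t}` and
`Q = {q_t < ⋯ < q_1}`. -/
def stripPairs (P Q : Finset ℕ) : List (ℕ × ℕ) := (P.sort (· ≤ ·)).zip (Q.sort (· ≥ ·))

/-- `(add^{p_1}_{q_1} ∘ ⋯ ∘ add^{p_t}_{q_t})(λ)`. -/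
noncomputable def iteratedAdd (lam : YoungDiagram) (P Q : Finset ℕ) : YoungDiagram :=
  (stripPairs P Q).foldr (fun pq nu => addOp lam pq.1 pq.2 nu) lam

/-- `(rem^{p_1}_{q_1} ∘ ⋯ ∘ rem^{p_t}_{q_t})(λ)`. -/
noncomputable def iteratedRem (lam : YoungDiagram) (P Q : Finset ℕ) : YoungDiagram :=
  (stripPairs P Q).foldr (fun pq nu => remOp lam pq.1 pq.2 nu) lam

/-- The `d`-th shortest height of a column of `λ` (among the distinct heights of its columns). -/
noncomputable def shortestColumn (lam : YoungDiagram) (d : ℕ) : ℕ :=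
  kthSmallest ((range (lam.rowLen 0)).image lam.colLen) d

/-- The `d`-th shortest length of a row of `λ` (among the distinct lengths of its rows). -/
noncomputable def shortestRow (lam : YoungDiagram) (d : ℕ) : ℕ :=
  kthSmallest ((range (lam.colLen 0)).image lam.rowLen) d

/-! ### A quadratic identity between determinants -/

section Exchange

variable {ι K : Type*} [Fintype ι] [DecidableEq ι] [Field K]

/-! The identity is an exchange relation between two bases of one vector space. To compare minors of
sizes `k` and `k + 1`, a minor of size `k` is written as one of size `k + 1` by adjoining the last
unit vector. The truncated columns of `X₊` indexed by the beads (Maya diagram) of `λ`, taken once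
with `k + 1` beads and once with `k` beads plus the unit vector, are the rows of two square matrices
`M₁` and `M₂`. Both are invertible, because the relevant minors of the generic `X` are nonzero.

With `Z = M₂ M₁⁻¹`, swapping the rows in a set `T` multiplies `det M₁ · det M₂` by `det Z_{TT} · det
(Z⁻¹)_{TT}`. Since `Z Z⁻¹ = 1`, this factor equals `det (1 + W)`, where `W` consists of the
off-diagonal blocks `Z_{T,Tᶜ}` and `(Z⁻¹)_{Tᶜ,T}` (`det_one_add_crossMatrix`). Expanding in
principal minors of `W` gives an alternating sum over pairs `P ⊆ T`, `Q ⊆ Tᶜ` with `#P = #Q`. Each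
term exchanges the rows `P` of `M₂` with the rows `Q` of `M₁` (`exchange_identity`). A term vanishes
as soon as an exchanged row is already present in the other matrix.

For `T` an initial segment ending at a corner, the full swap shifts the first beads by one and
produces `λ ∓ (1^ℓ)`. Because the two bead sets differ by a shift, `M₁` and `M₂` share most of their
rows, and only the rows at corners survive in the sum: `p ≤ d` on one side and `q ≥ d` on the other.
Exchanging them moves one bead past several others in each matrix, which adds a border strip in one
and removes one in the other (`exists_perm_beads_addStrips`, `exists_perm_beads_remStrips`). Both
moves pass the same number of beads, so the sorting signs cancel. The term `P = Q = ∅` is the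
left-hand side of the theorem, and the rest is the alternating sum with its sign reversed.

The conjugate statement uses the same exchange with the unit vector placed first instead of last.
This aligns the two bead sets differently and interchanges the roles of `P` and `Q`. -/

theorem exists_swapPerm (L : List (ι × ι)) (hL : (L.map Prod.fst ++ L.map Prod.snd).Nodup) :
    ∃ σ : Equiv.Perm ι, Equiv.Perm.sign σ = (-1) ^ L.length ∧
      (∀ x ∈ L, σ x.1 = x.2 ∧ σ x.2 = x.1) ∧
      ∀ i, i ∉ L.map Prod.fst → i ∉ L.map Prod.snd → σ i = i := by
  induction L with
  | nil => exact ⟨1, by simp⟩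
  | cons y L ih =>
    obtain ⟨p, q⟩ := y
    simp only [List.map_cons, List.cons_append, List.nodup_cons, List.mem_append, List.mem_cons,
      not_or] at hL
    obtain ⟨⟨hp1, hpq, hp2⟩, hL⟩ := hL
    rw [List.nodup_middle, List.nodup_cons, List.mem_append, not_or] at hL
    obtain ⟨⟨hq1, hq2⟩, hL⟩ := hL
    obtain ⟨σ, hs, hσ, hfix⟩ := ih hL
    have hne : ∀ x ∈ L, x.1 ≠ p ∧ x.1 ≠ q ∧ x.2 ≠ p ∧ x.2 ≠ q := by
      intro x hx
      have h1 := List.mem_map_of_mem (f := Prod.fst) hx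
      have h2 := List.mem_map_of_mem (f := Prod.snd) hx
      exact ⟨fun e => hp1 (e ▸ h1), fun e => hq1 (e ▸ h1), fun e => hp2 (e ▸ h2),
        fun e => hq2 (e ▸ h2)⟩
    refine ⟨Equiv.swap p q * σ, ?_, ?_, ?_⟩
    · rw [map_mul, hs, Equiv.Perm.sign_swap hpq, List.length_cons, pow_succ']
    · intro x hx
      rcases List.mem_cons.1 hx with rfl | hx
      · simp [hfix p hp1 hp2, hfix q hq1 hq2]
      · obtain ⟨h1, h2, h3, h4⟩ := hne x hx
        obtain ⟨h5, h6⟩ := hσ x hx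
        simp [Equiv.swap_apply_of_ne_of_ne, *]
    · intro i h1 h2
      simp only [List.map_cons, List.mem_cons, not_or] at h1 h2
      simp [hfix i h1.2 h2.2, Equiv.swap_apply_of_ne_of_ne h1.1 h2.1]

theorem exists_pairing {ι : Type*} {P Q : Finset ι} (hPQ : Disjoint P Q) (hc : #P = #Q) :
    ∃ L : List (ι × ι), (L.map Prod.fst ++ L.map Prod.snd).Nodup ∧
      L.map Prod.fst = P.toList ∧ L.map Prod.snd = Q.toList := by
  have h1 : (P.toList.zip Q.toList).map Prod.fst = P.toList :=
    List.map_fst_zip (by simp [hc])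
  have h2 : (P.toList.zip Q.toList).map Prod.snd = Q.toList :=
    List.map_snd_zip (by simp [hc])
  refine ⟨P.toList.zip Q.toList, ?_, h1, h2⟩
  rw [h1, h2]
  refine List.Nodup.append P.nodup_toList Q.nodup_toList ?_
  intro i hi hi'
  exact Finset.disjoint_left.1 hPQ (Finset.mem_toList.1 hi) (Finset.mem_toList.1 hi')

/-- `σ` exchanges the disjoint sets `P` and `Q` and fixes all other elements. -/
structure Exchanges (σ : Equiv.Perm ι) (P Q : Finset ι) : Prop where
  left : ∀ i ∈ P, σ i ∈ Q
  right : ∀ i ∈ Q, σ i ∈ P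
  fix : ∀ i, i ∉ P → i ∉ Q → σ i = i
  sign : Equiv.Perm.sign σ = (-1) ^ #P

theorem exists_exchanges_of_list (L : List (ι × ι))
    (hL : (L.map Prod.fst ++ L.map Prod.snd).Nodup) (P Q : Finset ι)
    (hP : ∀ i, i ∈ P ↔ i ∈ L.map Prod.fst) (hQ : ∀ i, i ∈ Q ↔ i ∈ L.map Prod.snd) :
    ∃ σ : Equiv.Perm ι, Exchanges σ P Q ∧ ∀ x ∈ L, σ x.1 = x.2 ∧ σ x.2 = x.1 := by
  obtain ⟨σ, h1, h2, h3⟩ := exists_swapPerm L hL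
  have hcard : #P = L.length := by
    have : P = (L.map Prod.fst).toFinset := by ext i; simp [hP]
    rw [this, List.toFinset_card_of_nodup hL.of_append_left, List.length_map]
  refine ⟨σ, ⟨fun i hi => ?_, fun i hi => ?_, fun i hi hi' => ?_, by rw [h1, hcard]⟩, h2⟩
  · obtain ⟨x, hx, rfl⟩ := List.mem_map.1 ((hP i).1 hi)
    rw [(h2 x hx).1]
    exact (hQ _).2 (List.mem_map_of_mem hx)
  · obtain ⟨x, hx, rfl⟩ := List.mem_map.1 ((hQ i).1 hi)
    rw [(h2 x hx).2]
    exact (hP _).2 (List.mem_map_of_mem hx)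
  · exact h3 i (fun h => hi ((hP i).2 h)) (fun h => hi' ((hQ i).2 h))

theorem exists_exchanges {P Q : Finset ι} (hPQ : Disjoint P Q) (hc : #P = #Q) :
    ∃ σ : Equiv.Perm ι, Exchanges σ P Q := by
  obtain ⟨L, h1, h2, h3⟩ := exists_pairing hPQ hc
  obtain ⟨σ, h, -⟩ := exists_exchanges_of_list L h1 P Q (by simp [h2]) (by simp [h3])
  exact ⟨σ, h⟩

/-- The matrix with the rows of `A` in `S` and the rows of `B` outside `S`. -/
def rowPiecewise {ι K : Type*} [DecidableEq ι] (S : Finset ι) (A B : Matrix ι ι K) :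
    Matrix ι ι K :=
  Matrix.of fun i j => if i ∈ S then A i j else B i j

theorem rowPiecewise_of_mem {ι K : Type*} [DecidableEq ι] {S : Finset ι}
    {A B : Matrix ι ι K} {i : ι} (h : i ∈ S) :
    rowPiecewise S A B i = A i := by
  ext j; simp [rowPiecewise, h]

theorem rowPiecewise_of_notMem {ι K : Type*} [DecidableEq ι] {S : Finset ι}
    {A B : Matrix ι ι K} {i : ι} (h : i ∉ S) :
    rowPiecewise S A B i = B i := by
  ext j; simp [rowPiecewise, h]

/-- Multilinearity in the rows: each row of the sum is taken from `W` or from the identity, so the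
terms are the principal minors of `W`. -/
theorem Matrix.det_one_add_eq_sum (W : Matrix ι ι K) :
    (1 + W).det = ∑ S : Finset ι, (rowPiecewise S W 1).det := by
  rw [add_comm]
  refine ((Matrix.detRowAlternating (n := ι) (R := K)).map_add_univ W (1 : Matrix ι ι K)).trans ?_
  refine Finset.sum_congr rfl fun S _ => ?_
  congr 1
  ext i j
  by_cases hi : i ∈ S
  · rw [rowPiecewise_of_mem hi]
    exact congrFun (Finset.piecewise_eq_of_mem S (fun i => W i) _ hi) j
  · rw [rowPiecewise_of_notMem hi]
    exact congrFun (Finset.piecewise_eq_of_notMem S (fun i => W i) _ hi) j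

/-- Unit rows on `T` make the matrix block triangular with an identity block, so only the
complementary principal minor matters. -/
theorem Matrix.det_eq_det_block {T : Finset ι} {A : Matrix ι ι K}
    (hA : ∀ i ∈ T, A i = (1 : Matrix ι ι K) i) :
    A.det = (A.toSquareBlockProp fun i => i ∉ T).det := by
  have h := A.twoBlockTriangular_det (fun i => i ∉ T) (by
    intro i hi j hj
    rw [hA i (not_not.1 hi), Matrix.one_apply_ne]
    rintro rfl
    exact hi hj)
  have h1 : (A.toSquareBlockProp fun i => ¬ i ∉ T) = 1 := by
    ext i j
    rw [Matrix.toSquareBlockProp_def, Matrix.of_apply, hA i (not_not.1 i.2)]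
    simp [Matrix.one_apply, Subtype.ext_iff]
  rw [h, h1, Matrix.det_one, mul_one]

theorem Matrix.det_eq_det_of_block {T : Finset ι} {A B : Matrix ι ι K}
    (hA : ∀ i ∈ T, A i = (1 : Matrix ι ι K) i) (hB : ∀ i ∈ T, B i = (1 : Matrix ι ι K) i)
    (hAB : ∀ i, i ∉ T → ∀ j, j ∉ T → A i j = B i j) : A.det = B.det := by
  rw [Matrix.det_eq_det_block hA, Matrix.det_eq_det_block hB]
  congr 1
  ext i j
  exact hAB i i.2 j j.2

/-- The blocks of `Z` with rows in `T` and columns outside `T`, and of `Z'` with rows outside `T`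
and columns in `T`. -/
def crossMatrix (T : Finset ι) (Z Z' : Matrix ι ι K) : Matrix ι ι K :=
  Matrix.of fun i j =>
    if i ∈ T then (if j ∈ T then 0 else Z i j) else (if j ∈ T then Z' i j else 0)

/-- The matrix on the left factors as (rows of `Z` in `T`, unit rows elsewhere) times (columns of
`Z'` in `T`, unit columns elsewhere): the relation `Z * Z' = 1` turns the `T × T` block of the
product into an identity block. -/
theorem det_one_add_crossMatrix (T : Finset ι) {Z Z' : Matrix ι ι K} (h : Z * Z' = 1) :
    (1 + crossMatrix T Z Z').det =
      (rowPiecewise T Z 1).det * (rowPiecewise T Z' 1).det := by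
  -- The column version of the second factor; transposing shows that it has the same determinant,
  -- namely the `T × T` minor of `Z'`.
  let F : Matrix ι ι K := Matrix.of fun i j => if j ∈ T then Z' i j else (1 : Matrix ι ι K) i j
  have hF : F.det = (rowPiecewise T Z' 1).det := by
    have h1 : ∀ i ∈ Tᶜ, F.transpose i = (1 : Matrix ι ι K) i := by
      intro i hi
      ext j
      simp [F, Finset.mem_compl.1 hi, Matrix.one_apply, eq_comm]
    have h2 : ∀ i ∈ Tᶜ, (rowPiecewise T Z' 1) i = (1 : Matrix ι ι K) i := by
      intro i hi
      exact rowPiecewise_of_notMem (Finset.mem_compl.1 hi)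
    rw [← Matrix.det_transpose, Matrix.det_eq_det_block h1, Matrix.det_eq_det_block h2,
      ← Matrix.det_transpose]
    congr 1
    ext i j
    have hi : (i : ι) ∈ T := by simpa using i.2
    have hj : (j : ι) ∈ T := by simpa using j.2
    simp [F, Matrix.toSquareBlockProp_def, hi, hj, rowPiecewise]
  rw [← hF, ← Matrix.det_mul]
  congr 1
  ext i j
  have hZ := congrFun (congrFun h i) j
  simp only [Matrix.mul_apply] at hZ
  by_cases hi : i ∈ T <;> by_cases hj : j ∈ T <;>
    simp [crossMatrix, Matrix.mul_apply, F, hi, hj, hZ, rowPiecewise, Matrix.one_apply]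
  · rintro rfl; exact absurd hi hj
  · rintro rfl; exact absurd hj hi

/-- Permuting the rows by `σ` brings the two off-diagonal blocks onto the diagonal, where they split
off as commuting factors supported on `Q` and on `P`. The sign is that of `σ`. -/
theorem det_piecewise_crossMatrix {T P Q : Finset ι} (hP : P ⊆ T) (hQ : Q ⊆ Tᶜ)
    {σ : Equiv.Perm ι} (hσ : Exchanges σ P Q) (Z Z' : Matrix ι ι K) :
    (rowPiecewise (P ∪ Q) (crossMatrix T Z Z') 1).det = (-1) ^ #P *
      ((Matrix.of fun i => if i ∈ Q then Z (σ i) else (1 : Matrix ι ι K) i).det *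
        (Matrix.of fun i => if i ∈ P then Z' (σ i) else (1 : Matrix ι ι K) i).det) := by
  have hQT : ∀ i ∈ Q, i ∉ T := fun i hi => Finset.mem_compl.1 (hQ hi)
  have hQ' : ∀ i ∈ T, i ∉ Q := fun i hi h => hQT i h hi
  have hP' : ∀ i, i ∉ T → i ∉ P := fun i hi h => hi (hP h)
  -- `X` and `Y` are the two factors with the columns in `T`, respectively outside `T`, erased in
  -- the replaced rows. Their determinants do not change, because those columns meet only unit rows
  -- of the other block.
  let X : Matrix ι ι K := Matrix.of fun i j =>
    if i ∈ Q then (if j ∈ T then 0 else Z (σ i) j) else (1 : Matrix ι ι K) i j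
  let Y : Matrix ι ι K := Matrix.of fun i j =>
    if i ∈ P then (if j ∈ T then Z' (σ i) j else 0) else (1 : Matrix ι ι K) i j
  have hX : (Matrix.of fun i => if i ∈ Q then Z (σ i) else (1 : Matrix ι ι K) i).det = X.det := by
    refine Matrix.det_eq_det_of_block (T := T) ?_ ?_ ?_
    · intro i hi; ext j; simp [hQ' i hi]
    · intro i hi; ext j; simp [X, hQ' i hi]
    · intro i _ j hj; by_cases h : i ∈ Q <;> simp [X, h, hj]
  have hY : (Matrix.of fun i => if i ∈ P then Z' (σ i) else (1 : Matrix ι ι K) i).det = Y.det := by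
    refine Matrix.det_eq_det_of_block (T := Tᶜ) ?_ ?_ ?_
    · intro i hi; ext j; simp [hP' i (Finset.mem_compl.1 hi)]
    · intro i hi; ext j; simp [Y, hP' i (Finset.mem_compl.1 hi)]
    · intro i _ j hj
      have hj : j ∈ T := by simpa using hj
      by_cases h : i ∈ P <;> simp [Y, h, hj]
  have hmul : (rowPiecewise (P ∪ Q) (crossMatrix T Z Z') 1).submatrix σ id
      = X * Y := by
    ext i j
    rw [Matrix.submatrix_apply, id, Matrix.mul_apply]
    by_cases hi : i ∈ Q
    · have h1 := hσ.right i hi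
      have h2 := hP h1
      rw [rowPiecewise_of_mem (Finset.mem_union_left _ h1)]
      have : ∀ k, X i k * Y k j = if k ∈ T then 0 else Z (σ i) k * (1 : Matrix ι ι K) k j := by
        intro k
        by_cases hk : k ∈ T
        · simp [X, hi, hk]
        · simp [X, Y, hi, hk, hP' k hk]
      simp only [this]
      by_cases hj : j ∈ T
      · rw [Finset.sum_eq_zero]
        · simp [crossMatrix, h2, hj]
        · intro k _
          by_cases hk : k ∈ T
          · simp [hk]
          · have : k ≠ j := by rintro rfl; exact hk hj
            simp [Matrix.one_apply_ne this]
      · rw [Finset.sum_eq_single j]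
        · simp [crossMatrix, h2, hj]
        · intro k _ hk
          simp [Matrix.one_apply_ne hk]
        · simp
    · have hXi : ∀ k, X i k = (1 : Matrix ι ι K) i k := by intro k; simp [X, hi]
      simp only [hXi, Matrix.one_apply, ite_mul, one_mul, zero_mul, Finset.sum_ite_eq,
        Finset.mem_univ, if_true]
      by_cases hi' : i ∈ P
      · have h1 := hσ.left i hi'
        rw [rowPiecewise_of_mem (Finset.mem_union_right _ h1)]
        simp [crossMatrix, Y, hi', hQT _ h1]
      · rw [hσ.fix i hi' hi, rowPiecewise_of_notMem (by simp [hi, hi'])]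
        simp [Y, hi']
  rw [hX, hY, ← Matrix.det_mul, ← hmul, Matrix.det_permute, hσ.sign]
  push_cast
  rw [← mul_assoc, ← mul_pow]
  simp

/-- In a nonzero Leibniz term, rows in `P` take columns outside `T`, rows in `Q` take columns in
`T`, and all other indices are fixed. Hence `σ` maps `T` onto `(T \ P) ∪ Q`, and counting forces `#P
= #Q`. -/
theorem det_piecewise_crossMatrix_of_card_ne {T P Q : Finset ι} (hP : P ⊆ T) (hQ : Q ⊆ Tᶜ)
    (hc : #P ≠ #Q) (Z Z' : Matrix ι ι K) :
    (rowPiecewise (P ∪ Q) (crossMatrix T Z Z') 1).det = 0 := by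
  rw [Matrix.det_apply]
  refine Finset.sum_eq_zero fun σ _ => ?_
  have hQT : ∀ i ∈ Q, i ∉ T := fun i hi => Finset.mem_compl.1 (hQ hi)
  suffices h : ∏ i, (rowPiecewise (P ∪ Q) (crossMatrix T Z Z') 1) (σ i) i = 0 by
    rw [h, smul_zero]
  by_contra h0
  rw [Finset.prod_eq_zero_iff] at h0
  push Not at h0
  have key : T.map σ.toEmbedding = (T \ P) ∪ Q := by
    ext i
    obtain ⟨i, rfl⟩ := σ.surjective i
    have hi := h0 i (Finset.mem_univ i)
    have e : σ i ∈ T.map σ.toEmbedding ↔ i ∈ T := by simp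
    rw [e, Finset.mem_union, Finset.mem_sdiff]
    by_cases h1 : σ i ∈ P
    · rw [rowPiecewise_of_mem (Finset.mem_union_left _ h1)] at hi
      have h2 := hP h1
      have h3 : σ i ∉ Q := fun h => hQT _ h h2
      simp [crossMatrix, h2] at hi
      simp [h1, h3, hi.1]
    · by_cases h2 : σ i ∈ Q
      · rw [rowPiecewise_of_mem (Finset.mem_union_right _ h2)] at hi
        simp [crossMatrix, hQT _ h2] at hi
        simp [h2, hi.1]
      · rw [rowPiecewise_of_notMem (by simp [h1, h2])] at hi
        have : σ i = i := by
          by_contra hne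
          exact hi (Matrix.one_apply_ne hne)
        rw [this] at h1 h2
        simp [this, h1, h2]
  have hcard := congrArg Finset.card key
  rw [Finset.card_map, Finset.card_union_of_disjoint, Finset.card_sdiff_of_subset hP] at hcard
  · have := Finset.card_le_card hP
    omega
  · rw [Finset.disjoint_left]
    intro i hi hi'
    exact hQT i hi' (Finset.mem_sdiff.1 hi).1

/-- The determinants obtained from the families of rows `M₁` and `M₂` by exchanging the rows of
`M₂` in `P` with the rows of `M₁` in `Q`. -/
def exchangedProduct (M₁ M₂ : Matrix ι ι K) (P Q : Finset ι) (σ : Equiv.Perm ι) : K :=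
  (Matrix.of fun i => if i ∈ Q then M₂ (σ i) else M₁ i).det *
    (Matrix.of fun i => if i ∈ P then M₁ (σ i) else M₂ i).det

/-- Right multiplication by `M₁` turns rows of `Z` into rows of `M₂` and unit rows into rows of
`M₁`; symmetrically for `Z'` and `M₂`. This converts minors of `Z` and `Z'` into determinants of
exchanged families. -/
theorem exchangedProduct_eq {M₁ M₂ Z Z' : Matrix ι ι K} (h : Z * M₁ = M₂) (h' : Z' * M₂ = M₁)
    (P Q : Finset ι) (σ : Equiv.Perm ι) :
    exchangedProduct M₁ M₂ P Q σ =
      ((Matrix.of fun i => if i ∈ Q then Z (σ i) else (1 : Matrix ι ι K) i).det *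
        (Matrix.of fun i => if i ∈ P then Z' (σ i) else (1 : Matrix ι ι K) i).det) *
      (M₁.det * M₂.det) := by
  rw [mul_mul_mul_comm, ← Matrix.det_mul, ← Matrix.det_mul, exchangedProduct]
  congr 3
  · ext i j
    by_cases hi : i ∈ Q
    · simp [Matrix.mul_apply, hi, ← h]
    · simp [Matrix.mul_apply, hi, Matrix.one_apply]
  · ext i j
    by_cases hi : i ∈ P
    · simp [Matrix.mul_apply, hi, ← h']
    · simp [Matrix.mul_apply, hi, Matrix.one_apply]

theorem det_piecewise_eq {M₁ M₂ Z : Matrix ι ι K} (h : Z * M₁ = M₂) (T : Finset ι) :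
    (rowPiecewise T M₂ M₁).det = (rowPiecewise T Z 1).det * M₁.det := by
  rw [← Matrix.det_mul]
  congr 1
  ext i j
  by_cases hi : i ∈ T
  · simp [Matrix.mul_apply, hi, ← h, rowPiecewise]
  · simp [Matrix.mul_apply, hi, Matrix.one_apply, rowPiecewise]

/-- The exchange identity: exchanging the rows of `M₁` and `M₂` in `T` is an alternating sum over
exchanges of rows of `M₂` in `T` with as many rows of `M₁` outside `T`. Only sets of rows in the
ranges of `φ` and `ψ` contribute if each other row of `M₂` in `T` (resp. of `M₁` outside `T`) is
also a row of `M₁` in `T` (resp. of `M₂` outside `T`). -/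
theorem exchange_identity {M₁ M₂ : Matrix ι ι K} (h₁ : M₁.det ≠ 0) (h₂ : M₂.det ≠ 0)
    (T : Finset ι) {α β : Type*} (A : Finset α) (B : Finset β) (φ : α → ι) (ψ : β → ι)
    (hφ : Set.InjOn φ A) (hψ : Set.InjOn ψ B) (hφT : ∀ a ∈ A, φ a ∈ T) (hψT : ∀ b ∈ B, ψ b ∉ T)
    (hT : ∀ i ∈ T, (∀ a ∈ A, φ a ≠ i) → ∃ j ∈ T, M₂ i = M₁ j)
    (hT' : ∀ i, i ∉ T → (∀ b ∈ B, ψ b ≠ i) → ∃ j, j ∉ T ∧ M₁ i = M₂ j)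
    (G : Finset α → Finset β → K)
    (hG : ∀ P ⊆ A, ∀ Q ⊆ B, #P = #Q → ∃ σ, Exchanges σ (P.image φ) (Q.image ψ) ∧
      exchangedProduct M₁ M₂ (P.image φ) (Q.image ψ) σ = G P Q) :
    (rowPiecewise T M₂ M₁).det * (rowPiecewise T M₁ M₂).det =
      ∑ P ∈ A.powerset, ∑ Q ∈ B.powerset, if #P = #Q then (-1) ^ #P * G P Q else 0 := by
  have u₁ : IsUnit M₁.det := isUnit_iff_ne_zero.2 h₁
  have u₂ : IsUnit M₂.det := isUnit_iff_ne_zero.2 h₂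
  set Z := M₂ * M₁⁻¹ with hZ
  set Z' := M₁ * M₂⁻¹ with hZ'
  have e₁ : Z * M₁ = M₂ := by rw [hZ, Matrix.mul_assoc, Matrix.nonsing_inv_mul _ u₁, mul_one]
  have e₂ : Z' * M₂ = M₁ := by rw [hZ', Matrix.mul_assoc, Matrix.nonsing_inv_mul _ u₂, mul_one]
  have e : Z * Z' = 1 := by
    rw [hZ', ← Matrix.mul_assoc, e₁, Matrix.mul_nonsing_inv _ u₂]
  set g : Finset ι → K := fun S => (rowPiecewise S (crossMatrix T Z Z') 1).det with hg
  -- The left side does not involve `σ`: any pairing of `P` with `Q` gives the same product, so the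
  -- nested pairing may be chosen later.
  have hgterm : ∀ P Q : Finset ι, P ⊆ T → Q ⊆ Tᶜ → ∀ σ, Exchanges σ P Q →
      g (P ∪ Q) * (M₁.det * M₂.det) = (-1) ^ #P * exchangedProduct M₁ M₂ P Q σ := by
    intro P Q hP hQ σ hσ
    rw [exchangedProduct_eq e₁ e₂, hg]
    simp only
    rw [det_piecewise_crossMatrix hP hQ hσ]
    ring
  have hvanish : ∀ P Q : Finset ι, P ⊆ T → Q ⊆ Tᶜ →
      ((∃ i ∈ P, ∀ a ∈ A, φ a ≠ i) ∨ ∃ i ∈ Q, ∀ b ∈ B, ψ b ≠ i) → g (P ∪ Q) = 0 := by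
    intro P Q hP hQ hbad
    by_cases hc : #P = #Q
    · have hd : Disjoint P Q := by
        rw [Finset.disjoint_left]
        intro i hi hi'
        exact Finset.mem_compl.1 (hQ hi') (hP hi)
      obtain ⟨σ, hσ⟩ := exists_exchanges hd hc
      have h := hgterm P Q hP hQ σ hσ
      have hz : exchangedProduct M₁ M₂ P Q σ = 0 := by
        have hsurj : ∀ i ∈ P, ∃ k ∈ Q, σ k = i := by
          intro i hi
          obtain ⟨k, rfl⟩ := σ.surjective i
          by_cases hk : k ∈ Q
          · exact ⟨k, hk, rfl⟩
          · by_cases hk' : k ∈ P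
            · exact absurd (hσ.left k hk') (fun h => Finset.disjoint_left.1 hd hi h)
            · rw [hσ.fix k hk' hk] at hi
              exact absurd hi hk'
        have hsurj' : ∀ i ∈ Q, ∃ k ∈ P, σ k = i := by
          intro i hi
          obtain ⟨k, rfl⟩ := σ.surjective i
          by_cases hk : k ∈ P
          · exact ⟨k, hk, rfl⟩
          · by_cases hk' : k ∈ Q
            · exact absurd (hσ.right k hk') (fun h => Finset.disjoint_left.1 hd h hi)
            · rw [hσ.fix k hk hk'] at hi
              exact absurd hi hk'
        rw [exchangedProduct]
        rcases hbad with ⟨i, hi, hia⟩ | ⟨i, hi, hib⟩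
        · obtain ⟨j, hj, hij⟩ := hT i (hP hi) hia
          obtain ⟨k, hk, rfl⟩ := hsurj i hi
          -- Row `j` of `M₁` stays in place because `j ∈ T`, while the same vector is brought in
          -- from row `i` of `M₂`: two equal rows.
          have hjQ : j ∉ Q := fun h => Finset.mem_compl.1 (hQ h) hj
          have hjk : k ≠ j := by rintro rfl; exact hjQ hk
          rw [Matrix.det_zero_of_row_eq hjk, zero_mul]
          funext x
          simp [hk, hjQ, hij]
        · obtain ⟨j, hj, hij⟩ := hT' i (Finset.mem_compl.1 (hQ hi)) hib
          obtain ⟨k, hk, rfl⟩ := hsurj' i hi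
          have hjP : j ∉ P := fun h => hj (hP h)
          have hjk : k ≠ j := by rintro rfl; exact hjP hk
          rw [mul_comm, Matrix.det_zero_of_row_eq hjk, zero_mul]
          funext x
          simp [hk, hjP, hij]
      rw [hz, mul_zero] at h
      -- Invertibility of both matrices allows the vanishing to be read back on the coefficient `g`
      -- itself.
      exact (mul_eq_zero.1 h).resolve_right (mul_ne_zero h₁ h₂)
    · exact det_piecewise_crossMatrix_of_card_ne hP hQ hc Z Z'
  have hsub : ∀ P ⊆ A, P.image φ ⊆ T := fun P hP i hi => by
    obtain ⟨a, ha, rfl⟩ := Finset.mem_image.1 hi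
    exact hφT a (hP ha)
  have hsub' : ∀ Q ⊆ B, Q.image ψ ⊆ Tᶜ := fun Q hQ i hi => by
    obtain ⟨a, ha, rfl⟩ := Finset.mem_image.1 hi
    exact Finset.mem_compl.2 (hψT a (hQ ha))
  have hcφ : ∀ P ⊆ A, #(P.image φ) = #P := fun P hP =>
    Finset.card_image_of_injOn (hφ.mono (by exact_mod_cast hP))
  have hcψ : ∀ Q ⊆ B, #(Q.image ψ) = #Q := fun Q hQ =>
    Finset.card_image_of_injOn (hψ.mono (by exact_mod_cast hQ))
  have hsum : ∑ S, g S = ∑ x ∈ A.powerset ×ˢ B.powerset, g (x.1.image φ ∪ x.2.image ψ) := by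
    -- `P` and `Q` can be recovered from the union of their images, one lying in `T` and the other
    -- outside. So the sum over pairs embeds in the sum over all subsets, and the subsets missed
    -- have vanishing coefficient.
    have hrec : ∀ P ⊆ A, ∀ Q ⊆ B, P = A.filter (fun a => φ a ∈ P.image φ ∪ Q.image ψ) ∧
        Q = B.filter (fun b => ψ b ∈ P.image φ ∪ Q.image ψ) := by
      intro P hP Q hQ
      constructor
      · ext a
        simp only [Finset.mem_filter, Finset.mem_union]
        refine ⟨fun h => ⟨hP h, Or.inl (Finset.mem_image_of_mem _ h)⟩, ?_⟩
        rintro ⟨h, h' | h'⟩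
        · obtain ⟨a', ha', e⟩ := Finset.mem_image.1 h'
          rwa [← hφ (hP ha') h e]
        · exact absurd (hφT a h) (Finset.mem_compl.1 (hsub' Q hQ h'))
      · ext a
        simp only [Finset.mem_filter, Finset.mem_union]
        refine ⟨fun h => ⟨hQ h, Or.inr (Finset.mem_image_of_mem _ h)⟩, ?_⟩
        rintro ⟨h, h' | h'⟩
        · exact absurd (hsub P hP h') (hψT a h)
        · obtain ⟨a', ha', e⟩ := Finset.mem_image.1 h'
          rwa [← hψ (hQ ha') h e]
    rw [← Finset.sum_image (f := g) (g := fun x : Finset α × Finset β =>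
      x.1.image φ ∪ x.2.image ψ)]
    · refine (Finset.sum_subset (Finset.subset_univ _) fun S _ hS => ?_).symm
      have e : S = (S ∩ T) ∪ (S \ T) := by
        rw [Finset.union_comm, Finset.sdiff_union_inter]
      rw [e]
      refine hvanish _ _ Finset.inter_subset_right (fun i hi => ?_) ?_
      · exact Finset.mem_compl.2 (Finset.mem_sdiff.1 hi).2
      · by_contra hno
        push Not at hno
        apply hS
        rw [Finset.mem_image]
        refine ⟨(A.filter fun a => φ a ∈ S, B.filter fun b => ψ b ∈ S), ?_, ?_⟩
        · simp
        · ext i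
          simp only [Finset.mem_union, Finset.mem_image, Finset.mem_filter]
          constructor
          · rintro (⟨a, ⟨_, ha⟩, rfl⟩ | ⟨a, ⟨_, ha⟩, rfl⟩) <;> exact ha
          · intro hi
            by_cases hiT : i ∈ T
            · obtain ⟨a, ha, rfl⟩ := hno.1 i (Finset.mem_inter.2 ⟨hi, hiT⟩)
              exact Or.inl ⟨a, ⟨ha, hi⟩, rfl⟩
            · obtain ⟨a, ha, rfl⟩ := hno.2 i (Finset.mem_sdiff.2 ⟨hi, hiT⟩)
              exact Or.inr ⟨a, ⟨ha, hi⟩, rfl⟩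
    · rintro ⟨P, Q⟩ hPQ ⟨P', Q'⟩ hPQ' he
      simp only [Finset.coe_product, Set.mem_prod, Finset.mem_coe, Finset.mem_powerset]
        at hPQ hPQ' he
      obtain ⟨h1, h2⟩ := hrec P hPQ.1 Q hPQ.2
      obtain ⟨h3, h4⟩ := hrec P' hPQ'.1 Q' hPQ'.2
      rw [he] at h1 h2
      exact Prod.ext (h1.trans h3.symm) (h2.trans h4.symm)
  have hdet : (1 + crossMatrix T Z Z').det = ∑ S, g S := Matrix.det_one_add_eq_sum _
  rw [det_piecewise_eq e₁, det_piecewise_eq e₂, mul_mul_mul_comm, ← det_one_add_crossMatrix T e,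
    hdet, hsum, Finset.sum_product, Finset.sum_mul]
  refine Finset.sum_congr rfl fun P hP => ?_
  rw [Finset.sum_mul]
  refine Finset.sum_congr rfl fun Q hQ => ?_
  rw [Finset.mem_powerset] at hP hQ
  split_ifs with hc
  · obtain ⟨σ, hσ, hσG⟩ := hG P hP Q hQ hc
    simp only
    rw [hgterm _ _ (hsub P hP) (hsub' Q hQ) σ hσ, hσG, hcφ P hP]
  · simp only [hg]
    rw [det_piecewise_crossMatrix_of_card_ne (hsub P hP) (hsub' Q hQ)
      (by rwa [hcφ P hP, hcψ Q hQ]), zero_mul]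

end Exchange

/-! ### Row lengths of diagrams obtained by adding and removing strips -/

theorem rowLen_eq_of_mem_iff {nu : YoungDiagram} {i k : ℕ} (h : ∀ j, (i, j) ∈ nu ↔ j < k) :
    nu.rowLen i = k := by
  have h1 := h k
  have h2 := h (nu.rowLen i)
  rw [YoungDiagram.mem_iff_lt_rowLen] at h1 h2
  omega

theorem mem_diagramOfCells {s : Finset (ℕ × ℕ)} (hs : IsLowerSet (s : Set (ℕ × ℕ)))
    (c : ℕ × ℕ) : c ∈ diagramOfCells s ↔ c ∈ s := by
  rw [diagramOfCells, dif_pos hs]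
  rfl

theorem rowLen_diagramOfCells {s : Finset (ℕ × ℕ)} {f : ℕ → ℕ} (hf : ∀ i, f (i + 1) ≤ f i)
    (hs : ∀ i j, (i, j) ∈ s ↔ j < f i) (i : ℕ) : (diagramOfCells s).rowLen i = f i := by
  have ha : Antitone f := antitone_nat_of_succ_le hf
  have hl : IsLowerSet (s : Set (ℕ × ℕ)) := by
    rintro ⟨a, b⟩ ⟨c, d⟩ hle hab
    have h1 : c ≤ a := hle.1
    have h2 : d ≤ b := hle.2
    have h3 := (hs a b).1 hab
    exact (hs c d).2 (lt_of_le_of_lt h2 (h3.trans_le (ha h1)))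
  refine rowLen_eq_of_mem_iff fun j => ?_
  rw [mem_diagramOfCells hl, hs]

/-- No lower-set hypothesis is needed, since the default value `⊥` is its own conjugate. -/
theorem diagramOfCells_transpose {s s' : Finset (ℕ × ℕ)} (h : ∀ c, c ∈ s' ↔ c.swap ∈ s) :
    (diagramOfCells s).transpose = diagramOfCells s' := by
  have hiff : IsLowerSet (s : Set (ℕ × ℕ)) ↔ IsLowerSet (s' : Set (ℕ × ℕ)) := by
    constructor
    · intro hl a b hab ha
      exact (h b).2 (hl (a := a.swap) (b := b.swap) ⟨hab.2, hab.1⟩ ((h a).1 ha))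
    · intro hl a b hab ha
      have h1 := (h b.swap).1 (hl (a := a.swap) (b := b.swap) ⟨hab.2, hab.1⟩ ((h a.swap).2 ha))
      exact h1
  by_cases hl : IsLowerSet (s : Set (ℕ × ℕ))
  · ext c
    rw [YoungDiagram.mem_cells, YoungDiagram.mem_cells, YoungDiagram.mem_transpose,
      mem_diagramOfCells hl, mem_diagramOfCells (hiff.1 hl), h]
  · rw [diagramOfCells, dif_neg hl, diagramOfCells, dif_neg (fun h => hl (hiff.2 h))]
    ext c
    simp

theorem mem_outsideBorder {nu : YoungDiagram} {i j : ℕ} :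
    (i, j) ∈ outsideBorder nu ↔ nu.rowLen i ≤ j ∧ ((0 < i ∧ j < nu.rowLen (i - 1)) ∨
      (0 < j ∧ j ≤ nu.rowLen i) ∨ (0 < i ∧ 0 < j ∧ j ≤ nu.rowLen (i - 1))) := by
  simp only [outsideBorder, Set.mem_ofPred_eq, YoungDiagram.mem_iff_lt_rowLen, not_lt,
    Prod.exists, Prod.mk.injEq]
  refine and_congr_right fun _ => ⟨?_, ?_⟩
  · rintro ⟨a, b, hab, ⟨rfl, rfl⟩ | ⟨rfl, rfl⟩ | ⟨rfl, rfl⟩⟩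
    · exact Or.inl ⟨by omega, hab⟩
    · exact Or.inr (Or.inl ⟨by omega, hab⟩)
    · exact Or.inr (Or.inr ⟨by omega, by omega, hab⟩)
  · rintro (⟨h1, h2⟩ | ⟨h1, h2⟩ | ⟨h1, h2, h3⟩)
    · exact ⟨i - 1, j, h2, Or.inl ⟨by omega, rfl⟩⟩
    · exact ⟨i, j - 1, by omega, Or.inr (Or.inl ⟨rfl, by omega⟩)⟩
    · exact ⟨i - 1, j - 1, by omega, Or.inr (Or.inr ⟨by omega, by omega⟩)⟩

theorem mem_insideBorder {nu : YoungDiagram} {i j : ℕ} :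
    (i, j) ∈ insideBorder nu ↔ j < nu.rowLen i ∧ nu.rowLen (i + 1) ≤ j + 1 := by
  simp [insideBorder, YoungDiagram.mem_iff_lt_rowLen]

theorem mem_substrip {B : Set (ℕ × ℕ)} {u v : ℕ × ℕ} {i j : ℕ} :
    (i, j) ∈ substrip B u v ↔ ((u.1 ≤ i ∧ i ≤ v.1) ∧ v.2 ≤ j ∧ j ≤ u.2) ∧ (i, j) ∈ B := by
  simp [substrip]

/-- Row `i` of the outside border reaches from column `rowLen i` to column `rowLen (i - 1)`, so
filling it makes the row one longer than the old row above. Only the top row stops earlier, at `j₀`;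
the strip ends at the first free cell of row `i₁`. The hypotheses place both end cells on the
border, with a separate condition when the strip starts in row `0`. -/
theorem rowLen_addStrip {nu : YoungDiagram} {i₀ j₀ i₁ : ℕ} (hi : i₀ ≤ i₁)
    (hj : nu.rowLen i₀ ≤ j₀) (hu : 0 < i₀ → j₀ < nu.rowLen (i₀ - 1))
    (hu' : i₀ = 0 → 0 < j₀ ∧ j₀ ≤ nu.rowLen 0)
    (hv : 0 < nu.rowLen i₁ ∨ 0 < i₁ ∧ 0 < nu.rowLen (i₁ - 1)) (i : ℕ) :
    (addStrip (i₀, j₀) (i₁, nu.rowLen i₁) nu).rowLen i =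
      if i = i₀ then j₀ + 1 else if i₀ < i ∧ i ≤ i₁ then nu.rowLen (i - 1) + 1
        else nu.rowLen i := by
  have anti := nu.rowLen_anti
  have h1 : (i₀, j₀) ∈ outsideBorder nu := by
    rw [mem_outsideBorder]
    refine ⟨hj, ?_⟩
    rcases Nat.eq_zero_or_pos i₀ with rfl | h
    · exact Or.inr (Or.inl (hu' rfl))
    · exact Or.inl ⟨h, hu h⟩
  have h2 : (i₁, nu.rowLen i₁) ∈ outsideBorder nu := by
    rw [mem_outsideBorder]
    have := anti (i₁ - 1) i₁ (by omega)
    omega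
  rw [addStrip, if_pos ⟨h1, h2⟩]
  refine rowLen_diagramOfCells
    (f := fun i => if i = i₀ then j₀ + 1 else if i₀ < i ∧ i ≤ i₁ then nu.rowLen (i - 1) + 1
        else nu.rowLen i) ?_ ?_ i
  · intro i
    have a1 := anti i (i + 1) (by omega)
    have a2 := anti (i - 1) i (by omega)
    simp only [Nat.add_sub_cancel]
    by_cases c1 : i = i₀
    · subst c1
      split_ifs <;> omega
    · by_cases c2 : i + 1 = i₀
      · subst c2
        have := hu (by omega)
        simp only [Nat.add_sub_cancel] at this
        split_ifs <;> omega
      · split_ifs <;> omega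
  · intro i j
    rw [Finset.mem_union, YoungDiagram.mem_cells, YoungDiagram.mem_iff_lt_rowLen, mem_substrip,
      mem_outsideBorder]
    simp only
    by_cases c1 : i = i₀
    · subst c1
      have a1 := anti i i₁ hi
      rw [if_pos rfl]
      constructor
      · omega
      · intro h
        rcases lt_or_ge j (nu.rowLen i) with h' | h'
        · exact Or.inl h'
        · refine Or.inr ⟨by omega, h', ?_⟩
          rcases Nat.eq_zero_or_pos i with rfl | hpos
          · have := hu' rfl
            omega
          · have := hu hpos
            omega
    · rw [if_neg c1]
      by_cases c2 : i₀ < i ∧ i ≤ i₁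
      · rw [if_pos c2]
        have a1 := anti i i₁ c2.2
        have a2 := anti i₀ (i - 1) (by omega)
        have a3 := anti (i - 1) i (by omega)
        have a4 := anti (i - 1) (i₁ - 1) (by omega)
        omega
      · rw [if_neg c2]
        omega

/-- Row `i` of the inside border starts at column `rowLen (i + 1) - 1`, so its removal leaves a row
one shorter than the old row below. Only the bottom row is cut at `j₁` instead. -/
theorem rowLen_remStrip {nu : YoungDiagram} {i₀ i₁ j₁ : ℕ} (hi : i₀ ≤ i₁)
    (hj : j₁ < nu.rowLen i₁) (hv : nu.rowLen (i₁ + 1) ≤ j₁) (i : ℕ) :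
    (remStrip (i₀, nu.rowLen i₀ - 1) (i₁, j₁) nu).rowLen i =
      if i = i₁ then j₁ else if i₀ ≤ i ∧ i < i₁ then nu.rowLen (i + 1) - 1
        else nu.rowLen i := by
  have anti := nu.rowLen_anti
  have a0 := anti i₀ i₁ hi
  have h1 : (i₀, nu.rowLen i₀ - 1) ∈ insideBorder nu := by
    rw [mem_insideBorder]
    have := anti i₀ (i₀ + 1) (by omega)
    omega
  have h2 : (i₁, j₁) ∈ insideBorder nu := by
    rw [mem_insideBorder]
    omega
  rw [remStrip, if_pos ⟨h1, h2⟩]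
  refine rowLen_diagramOfCells
    (f := fun i => if i = i₁ then j₁ else if i₀ ≤ i ∧ i < i₁ then nu.rowLen (i + 1) - 1
        else nu.rowLen i) ?_ ?_ i
  · intro i
    have a1 := anti i (i + 1) (by omega)
    have a2 := anti (i + 1) (i + 1 + 1) (by omega)
    by_cases c1 : i = i₁
    · subst c1
      split_ifs <;> omega
    · by_cases c2 : i + 1 = i₁
      · subst c2
        split_ifs <;> omega
      · split_ifs <;> omega
  · intro i j
    rw [Finset.mem_sdiff, YoungDiagram.mem_cells, YoungDiagram.mem_iff_lt_rowLen, mem_substrip,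
      mem_insideBorder]
    simp only
    have a1 := anti i (i + 1) (by omega)
    by_cases c1 : i = i₁
    · subst c1
      rw [if_pos rfl]
      omega
    · rw [if_neg c1]
      by_cases c2 : i₀ ≤ i ∧ i < i₁
      · rw [if_pos c2]
        have a2 := anti (i + 1) i₁ (by omega)
        have a3 := anti i₀ i (by omega)
        omega
      · rw [if_neg c2]
        omega

/-! ### Strips and conjugation of diagrams -/

theorem mem_outsideBorder_transpose {nu : YoungDiagram} {c : ℕ × ℕ} :
    c ∈ outsideBorder nu.transpose ↔ c.swap ∈ outsideBorder nu := by
  simp only [outsideBorder, Set.mem_ofPred_eq, YoungDiagram.mem_transpose]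
  refine and_congr_right fun _ => ⟨?_, ?_⟩
  · rintro ⟨b, hb, rfl | rfl | rfl⟩
    · exact ⟨b.swap, hb, Or.inr (Or.inl rfl)⟩
    · exact ⟨b.swap, hb, Or.inl rfl⟩
    · exact ⟨b.swap, hb, Or.inr (Or.inr rfl)⟩
  · rintro ⟨b, hb, h⟩
    refine ⟨b.swap, hb, ?_⟩
    obtain ⟨c1, c2⟩ := c
    simp only [Prod.swap, Prod.mk.injEq] at h ⊢
    tauto

theorem mem_insideBorder_transpose {nu : YoungDiagram} {c : ℕ × ℕ} :
    c ∈ insideBorder nu.transpose ↔ c.swap ∈ insideBorder nu := by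
  simp [insideBorder, YoungDiagram.mem_transpose]

/-- The border is preserved by conjugation but is traversed backwards, so the two ends change
places. The default values agree as well, so no admissibility is required. -/
theorem addStrip_transpose (u v : ℕ × ℕ) (nu : YoungDiagram) :
    (addStrip u v nu).transpose = addStrip v.swap u.swap nu.transpose := by
  have h : (u ∈ outsideBorder nu ∧ v ∈ outsideBorder nu) ↔
      (v.swap ∈ outsideBorder nu.transpose ∧ u.swap ∈ outsideBorder nu.transpose) := by
    simp [mem_outsideBorder_transpose, and_comm]
  rw [addStrip, addStrip]
  by_cases hc : u ∈ outsideBorder nu ∧ v ∈ outsideBorder nu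
  · rw [if_pos hc, if_pos (h.1 hc)]
    refine diagramOfCells_transpose fun ⟨a, b⟩ => ?_
    have := mem_outsideBorder_transpose (nu := nu) (c := (a, b))
    simp only [Prod.swap] at this
    simp only [Prod.swap, Finset.mem_union, YoungDiagram.mem_cells, mem_substrip,
      YoungDiagram.mem_transpose, this]
    tauto
  · rw [if_neg hc, if_neg (fun h' => hc (h.2 h'))]
    ext c
    simp

theorem remStrip_transpose (u v : ℕ × ℕ) (nu : YoungDiagram) :
    (remStrip u v nu).transpose = remStrip v.swap u.swap nu.transpose := by
  have h : (u ∈ insideBorder nu ∧ v ∈ insideBorder nu) ↔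
      (v.swap ∈ insideBorder nu.transpose ∧ u.swap ∈ insideBorder nu.transpose) := by
    simp [mem_insideBorder_transpose, and_comm]
  rw [remStrip, remStrip]
  by_cases hc : u ∈ insideBorder nu ∧ v ∈ insideBorder nu
  · rw [if_pos hc, if_pos (h.1 hc)]
    refine diagramOfCells_transpose fun ⟨a, b⟩ => ?_
    have := mem_insideBorder_transpose (nu := nu) (c := (a, b))
    simp only [Prod.swap] at this
    simp only [Prod.swap, Finset.mem_sdiff, YoungDiagram.mem_cells, mem_substrip,
      YoungDiagram.mem_transpose, this]
    tauto
  · rw [if_neg hc, if_neg (fun h' => hc (h.2 h'))]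
    ext c
    simp

/-! ### Beads and nested strips -/

/-- The elements of the Maya diagram of `nu` with `R` beads, in decreasing order. -/
def beads (R : ℕ) (nu : YoungDiagram) (i : Fin R) : ℕ := nu.rowLen i + (R - 1 - i)

theorem cycleIcc_val {R : ℕ} {a b : Fin R} (hab : a ≤ b) (k : Fin R) :
    ((Fin.cycleIcc a b k : Fin R) : ℕ) =
      if k = b then (a : ℕ) else if a ≤ k ∧ k < b then (k : ℕ) + 1 else k := by
  have : NeZero R := ⟨by have := a.2; omega⟩
  by_cases h1 : k = b
  · rw [if_pos h1, h1, Fin.cycleIcc_of_last hab]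
  · rw [if_neg h1]
    by_cases h2 : a ≤ k ∧ k < b
    · rw [if_pos h2, Fin.cycleIcc_of_ge_of_lt h2.1 h2.2, Fin.val_add_one_of_lt' ]
      have h3 : (k : ℕ) < b := h2.2
      have := b.2
      omega
    · rw [if_neg h2]
      rcases lt_or_ge k a with h3 | h3
      · rw [Fin.cycleIcc_of_lt h3]
      · rw [Fin.cycleIcc_of_gt]
        rcases lt_trichotomy k b with h4 | h4 | h4
        · exact absurd ⟨h3, h4⟩ h2
        · exact absurd h4 h1
        · exact h4

/-- Adding a strip moves the bead of row `i₁` up to row `i₀` and pushes the beads in between down by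
one index without changing their values; this is a cycle of sign `(-1) ^ (i₁ - i₀)`. The fold adds
the innermost strip first, and by nesting it alters only rows strictly between the end rows of the
next one, so data read off the original diagram remain valid. The statements about unchanged rows,
growth and fixed indices are the invariants of this induction. -/
theorem exists_perm_beads_addStrips (R : ℕ) (lam : YoungDiagram) {α : Type*} (i₀ j₀ i₁ : α → ℕ)
    (L : List α) (hL : L.Pairwise fun x y => i₀ x < i₀ y ∧ i₁ y < i₁ x)
    (hi : ∀ x ∈ L, i₀ x ≤ i₁ x) (hR : ∀ x ∈ L, i₁ x < R)
    (hj : ∀ x ∈ L, lam.rowLen (i₀ x) ≤ j₀ x)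
    (hu : ∀ x ∈ L, 0 < i₀ x → j₀ x < lam.rowLen (i₀ x - 1))
    (hu' : ∀ x ∈ L, i₀ x = 0 → 0 < j₀ x ∧ j₀ x ≤ lam.rowLen 0)
    (hv : ∀ x ∈ L, 0 < lam.rowLen (i₁ x) ∨ 0 < i₁ x ∧ 0 < lam.rowLen (i₁ x - 1))
    (nu : YoungDiagram)
    (hnu : nu = L.foldr (fun x nu => addStrip (i₀ x, j₀ x) (i₁ x, lam.rowLen (i₁ x)) nu) lam) :
    (∀ i, (∀ x ∈ L, i < i₀ x ∨ i₁ x < i) → nu.rowLen i = lam.rowLen i) ∧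
    (∀ i, lam.rowLen i ≤ nu.rowLen i) ∧
    ∃ π : Equiv.Perm (Fin R), Equiv.Perm.sign π = (-1) ^ (L.map fun x => i₁ x - i₀ x).sum ∧
      (∀ i : Fin R, (∀ x ∈ L, (i : ℕ) < i₀ x ∨ i₁ x < i) → π i = i) ∧
      (∀ x ∈ L, ∀ i : Fin R, (i : ℕ) = i₁ x → beads R nu (π i) = j₀ x + 1 + (R - 1 - i₀ x)) ∧
      (∀ i : Fin R, (∀ x ∈ L, (i : ℕ) ≠ i₁ x) → beads R nu (π i) = beads R lam i) := by
  induction L generalizing nu with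
  | nil =>
    subst hnu
    exact ⟨by simp, by simp, 1, by simp⟩
  | cons x L ih =>
    rw [List.pairwise_cons] at hL
    simp only [List.forall_mem_cons] at hi hR hj hu hu' hv
    obtain ⟨hA, hB, π, hs, hfix, h1, h2⟩ :=
      ih hL.2 hi.2 hR.2 hj.2 hu.2 hu'.2 hv.2 _ rfl
    rw [List.foldr_cons] at hnu
    set nu' := L.foldr (fun x nu => addStrip (i₀ x, j₀ x) (i₁ x, lam.rowLen (i₁ x)) nu) lam
      with hnu'
    have e0 : nu'.rowLen (i₀ x) = lam.rowLen (i₀ x) := hA _ fun y hy => Or.inl (hL.1 y hy).1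
    have e1 : nu'.rowLen (i₁ x) = lam.rowLen (i₁ x) := hA _ fun y hy => Or.inr (hL.1 y hy).2
    have e2 : nu'.rowLen (i₀ x - 1) = lam.rowLen (i₀ x - 1) :=
      hA _ fun y hy => Or.inl (lt_of_le_of_lt (Nat.sub_le _ _) (hL.1 y hy).1)
    have hlen := rowLen_addStrip (nu := nu') (j₀ := j₀ x) hi.1 (by rw [e0]; exact hj.1)
      (by rw [e2]; exact hu.1) (by
        intro h
        have := hu'.1 h
        have := hB 0
        omega) (by
        have := hB (i₁ x - 1)
        have := hv.1
        rw [e1]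
        omega)
    rw [e1, ← hnu] at hlen
    have hxR : i₁ x < R := hR.1
    have hxR' : i₀ x < R := lt_of_le_of_lt hi.1 hxR
    set a : Fin R := ⟨i₀ x, hxR'⟩ with ha
    set b : Fin R := ⟨i₁ x, hxR⟩ with hb
    have hab : a ≤ b := hi.1
    have hcyc := cycleIcc_val hab
    have hπb : π b = b := hfix b fun y hy => Or.inr (hL.1 y hy).2
    -- A row moved down by one index becomes one cell longer, so its bead keeps its value.
    have hstep : ∀ k : Fin R, k ≠ b → beads R nu (Fin.cycleIcc a b k) = beads R nu' k := by
      intro k hk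
      rw [beads, beads, hcyc, if_neg hk]
      by_cases h : a ≤ k ∧ k < b
      · have h3 : i₀ x ≤ k := h.1
        have h4 : (k : ℕ) < i₁ x := h.2
        rw [if_pos h, hlen, if_neg (by omega), if_pos (by omega), Nat.add_sub_cancel]
        omega
      · have h' : ¬(i₀ x ≤ k ∧ (k : ℕ) < i₁ x) := h
        have hk' : (k : ℕ) ≠ i₁ x := fun e => hk (Fin.ext e)
        have hi1 := hi.1
        rw [if_neg h, hlen, if_neg (by omega), if_neg (by omega)]
    refine ⟨?_, ?_, Fin.cycleIcc a b * π, ?_, ?_, ?_, ?_⟩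
    · intro i hix
      simp only [List.forall_mem_cons] at hix
      have hi1 := hi.1
      rw [hlen, if_neg (by omega), if_neg (by omega), hA i hix.2]
    · intro i
      have h3 := hB i
      have h4 := hj.1
      have h5 := nu'.rowLen_anti (i - 1) i (by omega)
      rw [hlen]
      split_ifs with h6
      · rw [h6]; omega
      · omega
      · omega
    · rw [map_mul, hs, Fin.sign_cycleIcc_of_le hab, ← pow_add, List.map_cons, List.sum_cons]
    · intro i hix
      simp only [List.forall_mem_cons] at hix
      have hi1 := hi.1
      rw [Equiv.Perm.mul_apply, hfix i hix.2]
      apply Fin.ext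
      rw [hcyc, if_neg, if_neg]
      · intro h
        have h3 : i₀ x ≤ i := h.1
        have h4 : (i : ℕ) < i₁ x := h.2
        omega
      · rintro rfl
        simp only [hb] at hix
        omega
    · intro y hy i hiy
      rw [Equiv.Perm.mul_apply]
      rcases List.mem_cons.1 hy with rfl | hy
      · have hib : i = b := Fin.ext hiy
        rw [hib, hπb, beads, hcyc, if_pos rfl, hlen, if_pos rfl]
      · rw [hstep, h1 y hy i hiy]
        intro h
        have h3 : i = b := π.injective (h.trans hπb.symm)
        have h4 := (hL.1 y hy).2
        rw [h3] at hiy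
        simp only [hb] at hiy
        omega
    · intro i hix
      simp only [List.forall_mem_cons] at hix
      rw [Equiv.Perm.mul_apply, hstep, h2 i hix.2]
      intro h
      have h3 : i = b := π.injective (h.trans hπb.symm)
      exact hix.1 (by rw [h3])

/-- The mirror image of the previous lemma: the bead of row `i₀` drops to row `i₁` and the beads in
between move up by one index, which is the inverse cycle. -/
theorem exists_perm_beads_remStrips (R : ℕ) (lam : YoungDiagram) {α : Type*} (i₀ i₁ j₁ : α → ℕ)
    (L : List α) (hL : L.Pairwise fun x y => i₀ x < i₀ y ∧ i₁ y < i₁ x)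
    (hi : ∀ x ∈ L, i₀ x ≤ i₁ x) (hR : ∀ x ∈ L, i₁ x < R)
    (hj : ∀ x ∈ L, j₁ x < lam.rowLen (i₁ x))
    (hv : ∀ x ∈ L, lam.rowLen (i₁ x + 1) ≤ j₁ x)
    (nu : YoungDiagram)
    (hnu : nu = L.foldr (fun x nu => remStrip (i₀ x, lam.rowLen (i₀ x) - 1) (i₁ x, j₁ x) nu) lam) :
    (∀ i, (∀ x ∈ L, i < i₀ x ∨ i₁ x < i) → nu.rowLen i = lam.rowLen i) ∧
    ∃ π : Equiv.Perm (Fin R), Equiv.Perm.sign π = (-1) ^ (L.map fun x => i₁ x - i₀ x).sum ∧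
      (∀ i : Fin R, (∀ x ∈ L, (i : ℕ) < i₀ x ∨ i₁ x < i) → π i = i) ∧
      (∀ x ∈ L, ∀ i : Fin R, (i : ℕ) = i₀ x → beads R nu (π i) = j₁ x + (R - 1 - i₁ x)) ∧
      (∀ i : Fin R, (∀ x ∈ L, (i : ℕ) ≠ i₀ x) → beads R nu (π i) = beads R lam i) := by
  induction L generalizing nu with
  | nil =>
    subst hnu
    exact ⟨by simp, 1, by simp⟩
  | cons x L ih =>
    rw [List.pairwise_cons] at hL
    simp only [List.forall_mem_cons] at hi hR hj hv
    obtain ⟨hA, π, hs, hfix, h1, h2⟩ := ih hL.2 hi.2 hR.2 hj.2 hv.2 _ rfl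
    rw [List.foldr_cons] at hnu
    set nu' := L.foldr (fun x nu => remStrip (i₀ x, lam.rowLen (i₀ x) - 1) (i₁ x, j₁ x) nu) lam
      with hnu'
    have e0 : nu'.rowLen (i₀ x) = lam.rowLen (i₀ x) := hA _ fun y hy => Or.inl (hL.1 y hy).1
    have e1 : nu'.rowLen (i₁ x) = lam.rowLen (i₁ x) := hA _ fun y hy => Or.inr (hL.1 y hy).2
    have e2 : nu'.rowLen (i₁ x + 1) = lam.rowLen (i₁ x + 1) :=
      hA _ fun y hy => Or.inr (Nat.lt_succ_of_lt (hL.1 y hy).2)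
    have hlen := rowLen_remStrip (nu := nu') (j₁ := j₁ x) hi.1 (by rw [e1]; exact hj.1)
      (by rw [e2]; exact hv.1)
    rw [e0, ← hnu] at hlen
    have hxR : i₁ x < R := hR.1
    have hxR' : i₀ x < R := lt_of_le_of_lt hi.1 hxR
    set a : Fin R := ⟨i₀ x, hxR'⟩ with ha
    set b : Fin R := ⟨i₁ x, hxR⟩ with hb
    have hab : a ≤ b := hi.1
    have hcyc := cycleIcc_val hab
    have hπa : π a = a := hfix a fun y hy => Or.inl (hL.1 y hy).1
    have hcb : Fin.cycleIcc a b b = a := Fin.ext (by rw [hcyc, if_pos rfl])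
    have hca : (Fin.cycleIcc a b)⁻¹ a = b := by rw [Equiv.Perm.inv_eq_iff_eq, hcb]
    have hstep : ∀ k : Fin R, k ≠ a →
        beads R nu ((Fin.cycleIcc a b)⁻¹ k) = beads R nu' k := by
      intro k hk
      obtain ⟨m, rfl⟩ := (Fin.cycleIcc a b).surjective k
      rw [Equiv.Perm.inv_def, Equiv.symm_apply_apply, beads, beads, hcyc]
      have hm : m ≠ b := by
        rintro rfl
        exact hk hcb
      have hm' : (m : ℕ) ≠ i₁ x := fun e => hm (Fin.ext e)
      rw [if_neg hm, hlen, if_neg hm']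
      by_cases h : a ≤ m ∧ m < b
      · have h3 : i₀ x ≤ m ∧ (m : ℕ) < i₁ x := h
        have h4 := nu'.rowLen_anti (m + 1) (i₁ x) (by omega)
        have h5 := hj.1
        rw [if_pos h, if_pos h3]
        omega
      · have h3 : ¬(i₀ x ≤ m ∧ (m : ℕ) < i₁ x) := h
        rw [if_neg h, if_neg h3]
    refine ⟨?_, (Fin.cycleIcc a b)⁻¹ * π, ?_, ?_, ?_, ?_⟩
    · intro i hix
      simp only [List.forall_mem_cons] at hix
      have hi1 := hi.1
      rw [hlen, if_neg (by omega), if_neg (by omega), hA i hix.2]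
    · rw [map_mul, hs, Equiv.Perm.sign_inv, Fin.sign_cycleIcc_of_le hab, ← pow_add,
        List.map_cons, List.sum_cons]
    · intro i hix
      simp only [List.forall_mem_cons] at hix
      have hi1 := hi.1
      rw [Equiv.Perm.mul_apply, hfix i hix.2, Equiv.Perm.inv_eq_iff_eq]
      apply Fin.ext
      rw [hcyc, if_neg, if_neg]
      · intro h
        have h3 : i₀ x ≤ i := h.1
        have h4 : (i : ℕ) < i₁ x := h.2
        omega
      · rintro rfl
        simp only [hb] at hix
        omega
    · intro y hy i hiy
      rw [Equiv.Perm.mul_apply]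
      rcases List.mem_cons.1 hy with rfl | hy
      · have hia : i = a := Fin.ext hiy
        rw [hia, hπa, hca, beads, hlen, if_pos rfl]
      · rw [hstep, h1 y hy i hiy]
        intro h
        have h3 : i = a := π.injective (h.trans hπa.symm)
        have h4 := (hL.1 y hy).1
        rw [h3] at hiy
        simp only [ha] at hiy
        omega
    · intro i hix
      simp only [List.forall_mem_cons] at hix
      rw [Equiv.Perm.mul_apply, hstep, h2 i hix.2]
      intro h
      have h3 : i = a := π.injective (h.trans hπa.symm)
      exact hix.1 (by rw [h3])

/-! ### Corners -/

theorem kthSmallest_mem {s : Finset ℕ} {p : ℕ} (h1 : 1 ≤ p) (h2 : p ≤ #s) :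
    kthSmallest s p ∈ s := by
  have hf : {x | x ∈ s}.Finite := s.finite_toSet
  have hcard : #hf.toFinset = #s := by congr 1; ext; simp
  exact Nat.nth_mem_of_lt_card (p := (· ∈ s)) hf (by rw [hcard]; omega)

theorem kthSmallest_lt {s : Finset ℕ} {p q : ℕ} (h1 : 1 ≤ p) (hpq : p < q) (h2 : q ≤ #s) :
    kthSmallest s p < kthSmallest s q := by
  have hf : {x | x ∈ s}.Finite := s.finite_toSet
  have hcard : #hf.toFinset = #s := by congr 1; ext; simp
  exact Nat.nth_lt_nth_of_lt_card (p := (· ∈ s)) hf (by omega) (by rw [hcard]; omega)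

theorem exists_kthSmallest_eq {s : Finset ℕ} {x : ℕ} (hx : x ∈ s) :
    ∃ p, 1 ≤ p ∧ p ≤ #s ∧ kthSmallest s p = x := by
  have hf : {x | x ∈ s}.Finite := s.finite_toSet
  have hcard : #hf.toFinset = #s := by congr 1; ext; simp
  obtain ⟨k, hk, h⟩ := Nat.exists_lt_card_finite_nth_eq (p := (· ∈ s)) hf hx
  rw [hcard] at hk
  exact ⟨k + 1, by omega, by omega, by simpa [kthSmallest] using h⟩

theorem mem_corners {lam : YoungDiagram} {i j : ℕ} :
    (i, j) ∈ corners lam ↔ lam.rowLen i = j + 1 ∧ lam.rowLen (i + 1) ≤ j := by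
  simp only [corners, Finset.mem_filter, YoungDiagram.mem_cells, YoungDiagram.mem_iff_lt_rowLen]
  omega

/-- Corner rows counted from `1` are exactly the indices, counted from `0`, of the rows strictly
shorter than their predecessor. This double reading of `cornerRow` is used throughout. -/
theorem mem_image_corners {lam : YoungDiagram} {x : ℕ} :
    x ∈ (corners lam).image (fun c => c.1 + 1) ↔ 0 < x ∧ lam.rowLen x < lam.rowLen (x - 1) := by
  rw [Finset.mem_image]
  constructor
  · rintro ⟨⟨i, j⟩, h, rfl⟩
    rw [mem_corners] at h
    simp only [Nat.add_sub_cancel]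
    omega
  · rintro ⟨h1, h2⟩
    refine ⟨(x - 1, lam.rowLen (x - 1) - 1), ?_, by simp; omega⟩
    rw [mem_corners, Nat.sub_add_cancel h1]
    omega

theorem card_image_corners (lam : YoungDiagram) :
    #((corners lam).image fun c => c.1 + 1) = #(corners lam) := by
  refine Finset.card_image_of_injOn ?_
  rintro ⟨i, j⟩ h ⟨i', j'⟩ h' e
  rw [Finset.mem_coe, mem_corners] at h h'
  simp only [Nat.add_right_cancel_iff] at e
  subst e
  rw [Prod.mk.injEq]
  omega

section Corners

variable {lam : YoungDiagram} {p q x : ℕ}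

theorem cornerRow_spec (h1 : 1 ≤ p) (h2 : p ≤ #(corners lam)) :
    0 < cornerRow lam p ∧ lam.rowLen (cornerRow lam p) < lam.rowLen (cornerRow lam p - 1) :=
  mem_image_corners.1 (kthSmallest_mem h1 (by rwa [card_image_corners]))

theorem cornerRow_lt (h1 : 1 ≤ p) (hpq : p < q) (h2 : q ≤ #(corners lam)) :
    cornerRow lam p < cornerRow lam q :=
  kthSmallest_lt h1 hpq (by rwa [card_image_corners])

theorem cornerRow_le (h1 : 1 ≤ p) (hpq : p ≤ q) (h2 : q ≤ #(corners lam)) :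
    cornerRow lam p ≤ cornerRow lam q := by
  rcases hpq.eq_or_lt with rfl | h
  · exact le_rfl
  · exact (cornerRow_lt h1 h h2).le

theorem exists_cornerRow_eq (h1 : 0 < x) (h2 : lam.rowLen x < lam.rowLen (x - 1)) :
    ∃ p, 1 ≤ p ∧ p ≤ #(corners lam) ∧ cornerRow lam p = x := by
  have := exists_kthSmallest_eq (mem_image_corners.2 ⟨h1, h2⟩)
  rwa [card_image_corners] at this

theorem exists_rowLen_lt_of_rowLen_lt {a b : ℕ} (h : lam.rowLen b < lam.rowLen a) :
    ∃ x, a < x ∧ x ≤ b ∧ lam.rowLen x < lam.rowLen (x - 1) := by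
  have hab : a ≤ b := by
    by_contra hc
    exact absurd (lam.rowLen_anti b a (by omega)) (by omega)
  induction b, hab using Nat.le_induction with
  | base => exact absurd h (lt_irrefl _)
  | succ b hb ih =>
    by_cases hc : lam.rowLen b < lam.rowLen a
    · obtain ⟨x, h1, h2, h3⟩ := ih hc
      exact ⟨x, h1, by omega, h3⟩
    · refine ⟨b + 1, by omega, le_rfl, ?_⟩
      rw [Nat.add_sub_cancel]
      omega

theorem cornerCol_eq (h2 : p ≤ #(corners lam)) :
    cornerCol lam p = lam.rowLen (cornerRow lam p - 1) := if_pos h2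

/-- Row lengths are constant between consecutive corner rows, since a drop would produce another
corner. For the last corner the same argument shows that nothing lies below it, in agreement with
the convention `m_{n+1} = 0`. -/
theorem cornerCol_succ (h1 : 1 ≤ q) (h2 : q ≤ #(corners lam)) :
    cornerCol lam (q + 1) = lam.rowLen (cornerRow lam q) := by
  by_cases h : q + 1 ≤ #(corners lam)
  · rw [cornerCol_eq h]
    have hlt := cornerRow_lt h1 (Nat.lt_add_one q) h
    refine le_antisymm (lam.rowLen_anti _ _ (by omega)) ?_
    by_contra hc
    obtain ⟨x, hx1, hx2, hx3⟩ := exists_rowLen_lt_of_rowLen_lt (not_le.1 hc)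
    obtain ⟨k, hk1, hk2, rfl⟩ := exists_cornerRow_eq (by omega) hx3
    have h3 : q < k := by
      by_contra hc
      have := cornerRow_le hk1 (not_lt.1 hc) h2
      omega
    have := cornerRow_le (by omega) (show q + 1 ≤ k from h3) hk2
    omega
  · rw [cornerCol, if_neg h]
    by_contra hc
    -- A row at or beyond the height of the first column is empty; a nonempty row below the last
    -- corner would therefore force one more drop.
    have h0 : lam.rowLen (max (cornerRow lam q) (lam.colLen 0)) = 0 := by
      by_contra h0
      have := YoungDiagram.mem_iff_lt_rowLen.2 (Nat.pos_of_ne_zero h0)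
      rw [YoungDiagram.mem_iff_lt_colLen] at this
      omega
    obtain ⟨x, hx1, hx2, hx3⟩ := exists_rowLen_lt_of_rowLen_lt (lam := lam)
      (a := cornerRow lam q) (b := max (cornerRow lam q) (lam.colLen 0)) (by omega)
    obtain ⟨k, hk1, hk2, rfl⟩ := exists_cornerRow_eq (by omega) hx3
    have := cornerRow_le hk1 (show k ≤ q by omega) h2
    omega

end Corners

/-! ### Column heights as corner rows -/

theorem lt_colLen_iff_lt_rowLen {lam : YoungDiagram} {i j : ℕ} :
    i < lam.colLen j ↔ j < lam.rowLen i := by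
  rw [← YoungDiagram.mem_iff_lt_colLen, YoungDiagram.mem_iff_lt_rowLen]

/-- A height `x` occurs among the columns exactly when row `x` is shorter than row `x - 1`; a
witnessing column is then column `rowLen x`. -/
theorem shortestColumn_eq (lam : YoungDiagram) (d : ℕ) :
    shortestColumn lam d = cornerRow lam d := by
  rw [shortestColumn, cornerRow]
  congr 1
  ext x
  rw [mem_image_corners, Finset.mem_image]
  constructor
  · rintro ⟨j, hj, rfl⟩
    rw [Finset.mem_range] at hj
    have h0 : 0 < lam.colLen j := lt_colLen_iff_lt_rowLen.2 hj
    have h1 := lt_colLen_iff_lt_rowLen (lam := lam) (i := lam.colLen j) (j := j)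
    have h2 := lt_colLen_iff_lt_rowLen (lam := lam) (i := lam.colLen j - 1) (j := j)
    omega
  · rintro ⟨h1, h2⟩
    refine ⟨lam.rowLen x, Finset.mem_range.2 (h2.trans_le (lam.rowLen_anti _ _ (by omega))), ?_⟩
    have h3 := lt_colLen_iff_lt_rowLen (lam := lam) (i := x) (j := lam.rowLen x)
    have h4 := lt_colLen_iff_lt_rowLen (lam := lam) (i := x - 1) (j := lam.rowLen x)
    omega

theorem shortestRow_eq (lam : YoungDiagram) (d : ℕ) :
    shortestRow lam d = cornerRow lam.transpose d := by
  rw [← shortestColumn_eq, shortestRow, shortestColumn, YoungDiagram.rowLen_transpose]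
  congr 2
  ext x
  simp

/-! ### Minors of the upper unitriangular factor -/

section Minors

variable {N : ℕ} {K : Type*} [Field K] (U : Matrix (Fin N) (Fin N) K)

/-- The minor of `U` with the first `R` rows and the columns listed by `c`. -/
def topMinor (R : ℕ) (c : Fin R → ℕ) : K :=
  (Matrix.of fun i j : Fin R => entry U j (c i)).det

theorem topMinor_comp_perm {R : ℕ} (c : Fin R → ℕ) (σ : Equiv.Perm (Fin R)) :
    topMinor U R (fun i => c (σ i)) = ((Equiv.Perm.sign σ : ℤ) : K) * topMinor U R c := by
  rw [topMinor, topMinor, ← Matrix.det_permute]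
  rfl

/-- The column of `U` with index `j`, cut off after `R` entries, and the last unit vector. -/
def topColumn (R : ℕ) : Option ℕ → Fin R → K
  | some j => fun i => entry U i j
  | none => fun i => if (i : ℕ) + 1 = R then 1 else 0

theorem det_topColumn_some {R : ℕ} {c : Fin R → Option ℕ} {b : Fin R → ℕ}
    (h : ∀ i, c i = some (b i)) : (Matrix.of fun i => topColumn U R (c i)).det = topMinor U R b := by
  rw [topMinor]
  congr 1
  ext i j
  simp [h, topColumn]

/-- Expansion along the unit vector deletes the last coordinate, leaving a minor with one row fewer.
-/
theorem det_topColumn_castSucc {R : ℕ} {c : Fin (R + 1) → Option ℕ} {b : Fin R → ℕ}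
    (h : ∀ i : Fin R, c i.castSucc = some (b i)) (h' : c (Fin.last R) = none) :
    (Matrix.of fun i => topColumn U (R + 1) (c i)).det = topMinor U R b := by
  rw [Matrix.det_succ_row _ (Fin.last R), Finset.sum_eq_single (Fin.last R)]
  · simp only [Fin.val_last, Matrix.of_apply, h', topColumn]
    rw [if_pos trivial, topMinor, mul_one, ← two_mul, pow_mul, neg_one_sq, one_pow, one_mul]
    congr 1
    ext i j
    simp [h]
  · intro j _ hj
    have : (j : ℕ) + 1 ≠ R + 1 := fun e => hj (Fin.ext (by simpa using e))
    simp [h', topColumn] at this ⊢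
    simp [this]
  · simp

/-- The same expansion with the unit vector in first place, which costs the sign `(-1) ^ R`. -/
theorem det_topColumn_succ {R : ℕ} {c : Fin (R + 1) → Option ℕ} {b : Fin R → ℕ}
    (h : ∀ i : Fin R, c i.succ = some (b i)) (h' : c 0 = none) :
    (Matrix.of fun i => topColumn U (R + 1) (c i)).det = (-1) ^ R * topMinor U R b := by
  rw [Matrix.det_succ_row_zero, Finset.sum_eq_single (Fin.last R)]
  · simp only [Fin.val_last, Matrix.of_apply, h', topColumn]
    rw [if_pos trivial, topMinor, mul_one]
    congr 2
    ext i j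
    simp [h]
  · intro j _ hj
    have : (j : ℕ) + 1 ≠ R + 1 := fun e => hj (Fin.ext (by simpa using e))
    simp [h', topColumn] at this ⊢
    simp [this]
  · simp

end Minors

/-- Beads are listed in decreasing order and the Maya diagram in increasing order. The resulting
sign depends on `r` alone, so it is common to all terms of the final identity. -/
theorem ninthSchur_eq_topMinor (N r : ℕ) (nu : YoungDiagram) :
    ninthSchur N r nu = ((Equiv.Perm.sign (Fin.revPerm (n := r)) : ℤ) : RatField N) *
      topMinor (gaussUpper N) r (beads r nu) := by
  rw [← topMinor_comp_perm, topMinor, ninthSchur, ninthSkewSchur, ← Matrix.det_transpose]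
  congr 1
  ext i j
  have h0 : (⊥ : YoungDiagram).rowLen j.rev = 0 :=
    rowLen_eq_of_mem_iff fun k => by simp
  have h1 : maya r ⊥ j = j := by rw [maya, h0, zero_add]
  have h2 : maya r nu i = beads r nu (Fin.revPerm i) := by
    rw [maya, beads, Fin.revPerm_apply, Fin.val_rev]
    have := i.2
    omega
  simp only [Matrix.transpose_apply, Matrix.of_apply, h1, h2]

/-! ### Nonvanishing of the minors -/

theorem genericMatrix_det_submatrix_ne_zero {N R : ℕ} (hR : R ≤ N) {c : Fin R → Fin N}
    (hc : Function.Injective c) :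
    ((genericMatrix N).submatrix (Fin.castLE hR) c).det ≠ 0 := by
  have hP : ((Matrix.mvPolynomialX (Fin N) (Fin N) ℂ).submatrix (Fin.castLE hR) c).det ≠ 0 := by
    intro h0
    -- Specialize the variables to a partial permutation matrix, for which the chosen submatrix is
    -- the identity.
    have h1 := congrArg (MvPolynomial.eval fun p : Fin N × Fin N =>
      if ∃ i : Fin R, Fin.castLE hR i = p.1 ∧ c i = p.2 then (1 : ℂ) else 0) h0
    rw [RingHom.map_det, map_zero] at h1
    have h2 : (MvPolynomial.eval fun p : Fin N × Fin N =>
        if ∃ i : Fin R, Fin.castLE hR i = p.1 ∧ c i = p.2 then (1 : ℂ) else 0).mapMatrix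
        ((Matrix.mvPolynomialX (Fin N) (Fin N) ℂ).submatrix (Fin.castLE hR) c) = 1 := by
      ext i j
      simp [Matrix.one_apply, hc.eq_iff]
    rw [h2, Matrix.det_one] at h1
    exact one_ne_zero h1
  intro h0
  apply hP
  apply IsFractionRing.injective (MvPolynomial (Fin N × Fin N) ℂ) (RatField N)
  rw [RingHom.map_det, map_zero, ← h0]
  rfl

/-- Since `L * D` is lower triangular, its first `R` rows involve only the first `R` rows of the
upper factor. A top minor of the generic matrix is thus a product having the given minor as a
factor. -/
theorem topMinor_gaussUpper_ne_zero {N R : ℕ} {c : Fin R → ℕ} (hc : Function.Injective c)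
    (hN : ∀ i, c i < N) : topMinor (gaussUpper N) R c ≠ 0 := by
  let c' : Fin R → Fin N := fun i => ⟨c i, hN i⟩
  have hc' : Function.Injective c' := fun i j h => hc (congrArg Fin.val h)
  have hR : R ≤ N := by simpa using Fintype.card_le_of_injective c' hc'
  have hX := genericMatrix_det_submatrix_ne_zero hR hc'
  obtain ⟨L, D, h⟩ := (exists_gaussUpper N).choose_spec.1
  change IsGaussDecomposition (genericMatrix N) L D (gaussUpper N) at h
  have hmul : (genericMatrix N).submatrix (Fin.castLE hR) c' =
      (L * D).submatrix (Fin.castLE hR) (Fin.castLE hR) *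
        (gaussUpper N).submatrix (Fin.castLE hR) c' := by
    ext i j
    rw [h.eq]
    simp only [Matrix.submatrix_apply]
    rw [Matrix.mul_apply, Matrix.mul_apply]
    simp only [Matrix.submatrix_apply]
    rw [← Finset.sum_image (s := Finset.univ) (g := Fin.castLE hR)
      (f := fun k => (L * D) (Fin.castLE hR i) k * gaussUpper N k (c' j))
      ((Fin.castLE_injective hR).injOn)]
    refine (Finset.sum_subset (Finset.subset_univ _) fun k _ hk => ?_).symm
    have hik : Fin.castLE hR i < k := by
      by_contra hcon
      have hk1 : (k : ℕ) ≤ i := not_lt.1 hcon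
      apply hk
      rw [Finset.mem_image]
      exact ⟨⟨k, by have := i.2; omega⟩, Finset.mem_univ _, rfl⟩
    have : (L * D) (Fin.castLE hR i) k = 0 := by
      rw [Matrix.mul_apply]
      refine Finset.sum_eq_zero fun m _ => ?_
      by_cases hm : m = k
      · rw [hm, h.lower_zero _ _ hik, zero_mul]
      · rw [h.diag hm, mul_zero]
    rw [this, zero_mul]
  rw [hmul, Matrix.det_mul] at hX
  have h1 := right_ne_zero_of_mul hX
  rw [← Matrix.det_transpose] at h1
  convert h1 using 1
  rw [topMinor]
  congr 1
  ext i j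
  have hj : (j : ℕ) < N := lt_of_lt_of_le j.2 hR
  simp [entry, hN i, hj, c', Fin.castLE]

theorem beads_lt {R : ℕ} {nu : YoungDiagram} {i j : Fin R} (h : i < j) :
    beads R nu j < beads R nu i := by
  have h1 := nu.rowLen_anti i j (le_of_lt h)
  have h2 : (i : ℕ) < j := h
  have := j.2
  rw [beads, beads]
  omega

theorem topMinor_beads_ne_zero {N R : ℕ} {nu : YoungDiagram} (h : nu.rowLen 0 + R ≤ N) :
    topMinor (gaussUpper N) R (beads R nu) ≠ 0 := by
  refine topMinor_gaussUpper_ne_zero (fun i j hij => ?_) fun i => ?_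
  · rcases lt_trichotomy i j with h | h | h
    · exact absurd hij (beads_lt h).ne'
    · exact h
    · exact absurd hij (beads_lt h).ne
  · have := nu.rowLen_anti 0 i (Nat.zero_le _)
    have := i.2
    rw [beads]
    omega

/-! ### Nested pairs of corners -/

section StripPairs

variable {P Q : Finset ℕ}

theorem map_fst_stripPairs (h : #P = #Q) :
    (stripPairs P Q).map Prod.fst = P.sort (· ≤ ·) := List.map_fst_zip (by simp [h])

theorem map_snd_stripPairs (h : #P = #Q) :
    (stripPairs P Q).map Prod.snd = Q.sort (· ≥ ·) := List.map_snd_zip (by simp [h])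

theorem fst_mem_of_mem_stripPairs (h : #P = #Q) {x : ℕ × ℕ} (hx : x ∈ stripPairs P Q) :
    x.1 ∈ P := by
  have := List.mem_map_of_mem (f := Prod.fst) hx
  rwa [map_fst_stripPairs h, Finset.mem_sort] at this

theorem snd_mem_of_mem_stripPairs (h : #P = #Q) {x : ℕ × ℕ} (hx : x ∈ stripPairs P Q) :
    x.2 ∈ Q := by
  have := List.mem_map_of_mem (f := Prod.snd) hx
  rwa [map_snd_stripPairs h, Finset.mem_sort] at this

theorem exists_mem_stripPairs_fst (h : #P = #Q) {p : ℕ} (hp : p ∈ P) :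
    ∃ x ∈ stripPairs P Q, x.1 = p := by
  rw [← Finset.mem_sort (· ≤ ·), ← map_fst_stripPairs h] at hp
  exact List.mem_map.1 hp

theorem exists_mem_stripPairs_snd (h : #P = #Q) {q : ℕ} (hq : q ∈ Q) :
    ∃ x ∈ stripPairs P Q, x.2 = q := by
  rw [← Finset.mem_sort (· ≥ ·), ← map_snd_stripPairs h] at hq
  exact List.mem_map.1 hq

theorem pairwise_stripPairs (h : #P = #Q) :
    (stripPairs P Q).Pairwise fun x y => x.1 < y.1 ∧ y.2 < x.2 := by
  refine List.Pairwise.and ?_ ?_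
  · rw [← List.pairwise_map (f := Prod.fst) (R := fun a b => a < b), map_fst_stripPairs h]
    exact (Finset.sortedLT_sort P).pairwise
  · rw [← List.pairwise_map (f := Prod.snd) (R := fun a b => b < a), map_snd_stripPairs h]
    exact (Finset.sortedGT_sort Q).pairwise

theorem exists_exchanges_stripPairs {ι : Type*} [Fintype ι] [DecidableEq ι] {φ ψ : ℕ → ι}
    (h : #P = #Q) (hφ : Set.InjOn φ P) (hψ : Set.InjOn ψ Q) (hd : ∀ p ∈ P, ∀ q ∈ Q, φ p ≠ ψ q) :
    ∃ σ : Equiv.Perm ι, Exchanges σ (P.image φ) (Q.image ψ) ∧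
      ∀ x ∈ stripPairs P Q, σ (φ x.1) = ψ x.2 ∧ σ (ψ x.2) = φ x.1 := by
  have e1 : ((stripPairs P Q).map fun x => (φ x.1, ψ x.2)).map Prod.fst =
      (P.sort (· ≤ ·)).map φ := by
    rw [← map_fst_stripPairs h, List.map_map, List.map_map]; rfl
  have e2 : ((stripPairs P Q).map fun x => (φ x.1, ψ x.2)).map Prod.snd =
      (Q.sort (· ≥ ·)).map ψ := by
    rw [← map_snd_stripPairs h, List.map_map, List.map_map]; rfl
  obtain ⟨σ, hσ, hσ'⟩ := exists_exchanges_of_list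
    ((stripPairs P Q).map fun x => (φ x.1, ψ x.2)) (by
      rw [e1, e2]
      refine List.Nodup.append ?_ ?_ ?_
      · refine List.Nodup.map_on (fun x hx y hy e => ?_) (Finset.sort_nodup _ _)
        exact hφ (by simpa using hx) (by simpa using hy) e
      · refine List.Nodup.map_on (fun x hx y hy e => ?_) (Finset.sort_nodup _ _)
        exact hψ (by simpa using hx) (by simpa using hy) e
      · intro i hi hi'
        obtain ⟨p, hp, rfl⟩ := List.mem_map.1 hi
        obtain ⟨q, hq, e⟩ := List.mem_map.1 hi'
        exact hd p (by simpa using hp) q (by simpa using hq) e.symm)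
    (P.image φ) (Q.image ψ) (by intro i; rw [e1]; simp) (by intro i; rw [e2]; simp)
  exact ⟨σ, hσ, fun x hx => hσ' _ (List.mem_map_of_mem (f := fun x => (φ x.1, ψ x.2)) hx)⟩

end StripPairs

/-- Group the pairs by common cardinality `t`. The term `t = 0` is split off, and the terms beyond
`min d (n - d + 1)` are empty because one of the two intervals is too small. -/
theorem sum_powerset_eq_sub {K : Type*} [Field K] {d n : ℕ} (h1 : 1 ≤ d)
    (G : Finset ℕ → Finset ℕ → K) :
    (∑ P ∈ (Icc 1 d).powerset, ∑ Q ∈ (Icc d n).powerset,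
      if #P = #Q then (-1) ^ #P * G P Q else 0) =
    G ∅ ∅ - ∑ t ∈ Icc 1 (min d (n - d + 1)), (-1) ^ (t - 1) *
      ∑ P ∈ powersetCard t (Icc 1 d), ∑ Q ∈ powersetCard t (Icc d n), G P Q := by
  have e1 : ∀ P : Finset ℕ, (∑ Q ∈ (Icc d n).powerset,
      if #P = #Q then (-1) ^ #P * G P Q else 0) =
      (-1) ^ #P * ∑ Q ∈ powersetCard #P (Icc d n), G P Q := by
    intro P
    rw [← Finset.sum_filter, Finset.mul_sum]
    refine Finset.sum_congr ?_ fun _ _ => rfl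
    ext Q
    rw [Finset.mem_filter, Finset.mem_powersetCard, Finset.mem_powerset, eq_comm]
  have e2 : range (#(Icc 1 d) + 1) = insert 0 (Icc 1 d) := by
    ext t
    simp only [Nat.card_Icc, Finset.mem_range, Finset.mem_insert, Finset.mem_Icc]
    omega
  rw [Finset.sum_congr rfl fun P _ => e1 P, Finset.sum_powerset, e2,
    Finset.sum_insert (by simp), sub_eq_add_neg, ← Finset.sum_neg_distrib]
  congr 1
  · simp
  · rw [← Finset.sum_subset (s₁ := Icc 1 (min d (n - d + 1)))]
    · refine Finset.sum_congr rfl fun t ht => ?_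
      obtain ⟨t, rfl⟩ : ∃ u, t = u + 1 := ⟨t - 1, by have := (Finset.mem_Icc.1 ht).1; omega⟩
      rw [Nat.add_sub_cancel, ← neg_mul, Finset.mul_sum]
      refine Finset.sum_congr rfl fun P hP => ?_
      rw [(Finset.mem_powersetCard.1 hP).2, pow_succ]
      ring
    · intro t ht
      rw [Finset.mem_Icc] at ht ⊢
      omega
    · intro t ht ht'
      rw [Finset.mem_Icc] at ht ht'
      refine Finset.sum_eq_zero fun P hP => ?_
      rw [(Finset.mem_powersetCard.1 hP).2, Finset.powersetCard_eq_empty.2, Finset.sum_empty,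
        mul_zero]
      rw [Nat.card_Icc]
      omega

/-! ### Adding and removing columns -/

theorem rowLen_addColumn (lam : YoungDiagram) (l i : ℕ) :
    (addColumn lam l).rowLen i = if i < l then lam.rowLen i + 1 else lam.rowLen i := by
  refine rowLen_diagramOfCells (f := fun i => if i < l then lam.rowLen i + 1 else lam.rowLen i)
    ?_ ?_ i
  · intro i
    have := lam.rowLen_anti i (i + 1) (by omega)
    split_ifs <;> omega
  · intro i j
    simp only [Finset.mem_union, YoungDiagram.mem_cells, YoungDiagram.mem_iff_lt_rowLen,
      Finset.mem_image, Finset.mem_range, Prod.mk.injEq]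
    constructor
    · rintro (h | ⟨a, h, rfl, rfl⟩)
      · split_ifs <;> omega
      · rw [if_pos h]; omega
    · split_ifs with h
      · intro hj
        rcases Nat.lt_succ_iff_lt_or_eq.1 hj with h' | h'
        · exact Or.inl h'
        · exact Or.inr ⟨i, h, rfl, h'.symm⟩
      · exact Or.inl

theorem rowLen_removeColumn {lam : YoungDiagram} {l : ℕ}
    (hl : lam.rowLen l < lam.rowLen (l - 1)) (i : ℕ) :
    (removeColumn lam l).rowLen i = if i < l then lam.rowLen i - 1 else lam.rowLen i := by
  refine rowLen_diagramOfCells (f := fun i => if i < l then lam.rowLen i - 1 else lam.rowLen i)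
    ?_ ?_ i
  · intro i
    have := lam.rowLen_anti i (i + 1) (by omega)
    by_cases h : i + 1 = l
    · subst h
      rw [Nat.add_sub_cancel] at hl
      split_ifs <;> omega
    · split_ifs <;> omega
  · intro i j
    simp only [Finset.mem_filter, YoungDiagram.mem_cells, YoungDiagram.mem_iff_lt_rowLen]
    split_ifs <;> omega

/-! ### The identity for two consecutive numbers of rows -/

/-- The exchange identity for the first `l` rows, `l` being the `d`-th corner row. In row `i`, `M₁`
carries the bead `λ_i + k - i` and `M₂` the bead `λ_i + k - 1 - i`, so row `i` of `M₂` equals row `i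
+ 1` of `M₁` unless the row length drops there. -/
theorem topMinor_beads_mul_beads_eq {N k : ℕ} (lam : YoungDiagram) (hk : lam.colLen 0 ≤ k)
    (hN : lam.rowLen 0 + (k + 1) ≤ N) {n d : ℕ} (hn : #(corners lam) = n) (hd1 : 1 ≤ d)
    (hdn : d ≤ n) :
    topMinor (gaussUpper N) (k + 1) (beads (k + 1) (removeColumn lam (cornerRow lam d))) *
        topMinor (gaussUpper N) k (beads k (addColumn lam (cornerRow lam d))) =
      ∑ P ∈ (Icc 1 d).powerset, ∑ Q ∈ (Icc d n).powerset, if #P = #Q then (-1) ^ #P *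
        (topMinor (gaussUpper N) (k + 1) (beads (k + 1) (iteratedAdd lam P Q)) *
          topMinor (gaussUpper N) k (beads k (iteratedRem lam P Q))) else 0 := by
  set U := gaussUpper N
  set l := cornerRow lam d with hl
  have rpos : ∀ p, 1 ≤ p → p ≤ n → 0 < cornerRow lam p := fun p h h' =>
    (cornerRow_spec h (by rwa [hn])).1
  have rdrop : ∀ p, 1 ≤ p → p ≤ n →
      lam.rowLen (cornerRow lam p) < lam.rowLen (cornerRow lam p - 1) := fun p h h' =>
    (cornerRow_spec h (by rwa [hn])).2
  have rlt : ∀ p q, 1 ≤ p → p < q → q ≤ n → cornerRow lam p < cornerRow lam q :=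
    fun p q h h' h'' => cornerRow_lt h h' (by rwa [hn])
  have rle : ∀ p q, 1 ≤ p → p ≤ q → q ≤ n → cornerRow lam p ≤ cornerRow lam q :=
    fun p q h h' h'' => cornerRow_le h h' (by rwa [hn])
  have rk : ∀ p, 1 ≤ p → p ≤ n → cornerRow lam p ≤ k := by
    intro p h h'
    have h1 := rdrop p h h'
    have h2 := rpos p h h'
    have h3 : cornerRow lam p - 1 < lam.colLen 0 := lt_colLen_iff_lt_rowLen.2 (by omega)
    omega
  have rex : ∀ x, 0 < x → lam.rowLen x < lam.rowLen (x - 1) →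
      ∃ p, 1 ≤ p ∧ p ≤ n ∧ cornerRow lam p = x := by
    intro x h h'
    rw [← hn]
    exact exists_cornerRow_eq h h'
  have mcol : ∀ p, p ≤ n → cornerCol lam p = lam.rowLen (cornerRow lam p - 1) :=
    fun p h => cornerCol_eq (by rwa [hn])
  have mcol' : ∀ q, 1 ≤ q → q ≤ n → cornerCol lam (q + 1) = lam.rowLen (cornerRow lam q) :=
    fun q h h' => cornerCol_succ h (by rwa [hn])
  have hlpos : 0 < l := rpos d hd1 hdn
  have hlk : l ≤ k := rk d hd1 hdn
  let c₁ : Fin (k + 1) → Option ℕ := fun i => some (beads (k + 1) lam i)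
  let c₂ : Fin (k + 1) → Option ℕ := fun i =>
    if (i : ℕ) < k then some (lam.rowLen i + (k - 1 - i)) else none
  let M₁ : Matrix (Fin (k + 1)) (Fin (k + 1)) (RatField N) :=
    Matrix.of fun i => topColumn U (k + 1) (c₁ i)
  let M₂ : Matrix (Fin (k + 1)) (Fin (k + 1)) (RatField N) :=
    Matrix.of fun i => topColumn U (k + 1) (c₂ i)
  have hc₂ : ∀ i : Fin k, c₂ i.castSucc = some (beads k lam i) := by
    intro i
    simp [c₂, beads]
  have hc₂' : c₂ (Fin.last k) = none := by simp [c₂]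
  have hM₁ : M₁.det ≠ 0 := by
    rw [det_topColumn_some U (fun i => rfl)]
    exact topMinor_beads_ne_zero hN
  have hM₂ : M₂.det ≠ 0 := by
    rw [det_topColumn_castSucc U hc₂ hc₂']
    exact topMinor_beads_ne_zero (by omega)
  let T : Finset (Fin (k + 1)) := Finset.univ.filter fun i => (i : ℕ) < l
  have hT : ∀ i : Fin (k + 1), i ∈ T ↔ (i : ℕ) < l := by intro i; simp [T]
  -- The minimum with `k` only serves to define the map on all of `ℕ`; at actual corners it has no
  -- effect.
  let φ : ℕ → Fin (k + 1) := fun p => ⟨min (cornerRow lam p - 1) k, by omega⟩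
  let ψ : ℕ → Fin (k + 1) := fun q => ⟨min (cornerRow lam q) k, by omega⟩
  have hφ : ∀ p, 1 ≤ p → p ≤ n → ((φ p : Fin (k + 1)) : ℕ) = cornerRow lam p - 1 := by
    intro p h h'
    have := rk p h h'
    simp only [φ]
    omega
  have hψ : ∀ q, 1 ≤ q → q ≤ n → ((ψ q : Fin (k + 1)) : ℕ) = cornerRow lam q := by
    intro p h h'
    have := rk p h h'
    simp only [ψ]
    omega
  have hφinj : Set.InjOn φ (Icc 1 d) := by
    intro p hp q hq e
    rw [Finset.mem_coe, Finset.mem_Icc] at hp hq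
    have e' := congrArg Fin.val e
    rw [hφ p hp.1 (by omega), hφ q hq.1 (by omega)] at e'
    have := rpos p hp.1 (by omega)
    have := rpos q hq.1 (by omega)
    rcases lt_trichotomy p q with h | h | h
    · have := rlt p q hp.1 h (by omega)
      omega
    · exact h
    · have := rlt q p hq.1 h (by omega)
      omega
  have hψinj : Set.InjOn ψ (Icc d n) := by
    intro p hp q hq e
    rw [Finset.mem_coe, Finset.mem_Icc] at hp hq
    have e' := congrArg Fin.val e
    rw [hψ p (by omega) hp.2, hψ q (by omega) hq.2] at e'
    rcases lt_trichotomy p q with h | h | h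
    · have := rlt p q (by omega) h (by omega)
      omega
    · exact h
    · have := rlt q p (by omega) h (by omega)
      omega
  have hφT : ∀ p ∈ Icc 1 d, φ p ∈ T := by
    intro p hp
    rw [Finset.mem_Icc] at hp
    rw [hT, hφ p hp.1 (by omega)]
    have := rle p d hp.1 hp.2 hdn
    have := rpos p hp.1 (by omega)
    omega
  have hψT : ∀ q ∈ Icc d n, ψ q ∉ T := by
    intro q hq
    rw [Finset.mem_Icc] at hq
    rw [hT, hψ q (by omega) hq.2]
    have := rle d q hd1 hq.1 hq.2
    omega
  have main := exchange_identity hM₁ hM₂ T (Icc 1 d) (Icc d n) φ ψ hφinj hψinj hφT hψT ?_ ?_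
    (fun P Q => topMinor U (k + 1) (beads (k + 1) (iteratedAdd lam P Q)) *
          topMinor U k (beads k (iteratedRem lam P Q))) ?_
  · rw [← main]
    congr 1
    · rw [← det_topColumn_some U (c := fun i => if i ∈ T then c₂ i else c₁ i)]
      · congr 1
        ext i j
        by_cases hi : i ∈ T <;> simp [rowPiecewise, hi, M₁, M₂]
      · intro i
        rw [beads, rowLen_removeColumn (rdrop d hd1 hdn)]
        by_cases hi : (i : ℕ) < l
        · rw [if_pos ((hT i).2 hi), if_pos hi]
          simp only [c₂]
          have h1 : lam.rowLen l < lam.rowLen (l - 1) := rdrop d hd1 hdn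
          have h2 := lam.rowLen_anti i (l - 1) (by omega)
          rw [if_pos (by omega)]
          congr 1
          omega
        · rw [if_neg (fun h => hi ((hT i).1 h)), if_neg hi]
          rfl
    · rw [← det_topColumn_castSucc U (c := fun i => if i ∈ T then c₁ i else c₂ i)]
      · congr 1
        ext i j
        by_cases hi : i ∈ T <;> simp [rowPiecewise, hi, M₁, M₂]
      · intro i
        rw [beads, rowLen_addColumn]
        by_cases hi : (i : ℕ) < l
        · rw [if_pos ((hT _).2 hi), if_pos hi]
          simp only [c₁, beads, Fin.val_castSucc]
          congr 1
          omega
        · rw [if_neg (fun h => hi ((hT _).1 h)), if_neg hi, hc₂, beads]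
      · rw [if_neg, hc₂']
        rw [hT, Fin.val_last]
        omega
  -- Away from the corners `p ≤ d`, row `i` of `M₂` already occurs as row `i + 1` of `M₁`, still
  -- inside `T`.
  · intro i hi hno
    rw [hT] at hi
    have h1 : lam.rowLen (i + 1) = lam.rowLen i := by
      by_contra hne
      have := lam.rowLen_anti i (i + 1) (by omega)
      obtain ⟨p, hp1, hp2, hp⟩ := rex (i + 1) (by omega) (by rw [Nat.add_sub_cancel]; omega)
      have hpd : p ≤ d := by
        by_contra hc
        have := rlt d p hd1 (by omega) hp2
        omega
      refine hno p (Finset.mem_Icc.2 ⟨hp1, hpd⟩) (Fin.ext ?_)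
      rw [hφ p hp1 hp2]
      omega
    have h2 : (i : ℕ) + 1 ≠ l := by
      intro h
      refine hno d (Finset.mem_Icc.2 ⟨hd1, le_rfl⟩) (Fin.ext ?_)
      rw [hφ d hd1 hdn]
      omega
    refine ⟨⟨i + 1, by omega⟩, (hT _).2 (by simp only; omega), ?_⟩
    have : c₂ i = c₁ ⟨i + 1, by omega⟩ := by
      simp only [c₁, c₂, beads]
      rw [if_pos (by omega), h1]
      congr 1
      omega
    exact congrArg (topColumn U (k + 1)) this
  -- Away from the corners `q ≥ d`, row `i` of `M₁` already occurs as row `i - 1` of `M₂`, still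
  -- outside `T`.
  · intro i hi hno
    rw [hT] at hi
    have h2 : (i : ℕ) ≠ l := by
      intro h
      refine hno d (Finset.mem_Icc.2 ⟨le_rfl, hdn⟩) (Fin.ext ?_)
      rw [hψ d hd1 hdn]
      omega
    have h1 : lam.rowLen i = lam.rowLen (i - 1) := by
      by_contra hne
      have := lam.rowLen_anti (i - 1) i (by omega)
      obtain ⟨q, hq1, hq2, hq⟩ := rex i (by omega) (by omega)
      have hqd : d ≤ q := by
        by_contra hc
        have := rlt q d hq1 (by omega) hdn
        omega
      refine hno q (Finset.mem_Icc.2 ⟨hqd, hq2⟩) (Fin.ext ?_)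
      rw [hψ q hq1 hq2]
      omega
    refine ⟨⟨i - 1, by omega⟩, (fun h => by have := (hT _).1 h; simp only at this; omega), ?_⟩
    have : c₁ i = c₂ ⟨i - 1, by omega⟩ := by
      simp only [c₁, c₂, beads]
      have := i.2
      rw [if_pos (by omega), h1]
      congr 1
      omega
    exact congrArg (topColumn U (k + 1)) this
  · intro P hP Q hQ hPQ
    have hP' : ∀ p ∈ P, 1 ≤ p ∧ p ≤ d := fun p hp => Finset.mem_Icc.1 (hP hp)
    have hQ' : ∀ q ∈ Q, d ≤ q ∧ q ≤ n := fun q hq => Finset.mem_Icc.1 (hQ hq)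
    obtain ⟨σ, hσ, hσ'⟩ := exists_exchanges_stripPairs hPQ
      (hφinj.mono (by exact_mod_cast hP)) (hψinj.mono (by exact_mod_cast hQ))
      (fun p hp q hq e => hψT q (hQ hq) (e ▸ hφT p (hP hp)))
    refine ⟨σ, hσ, ?_⟩
    have hL1 : ∀ x ∈ stripPairs P Q, 1 ≤ x.1 ∧ x.1 ≤ d :=
      fun x hx => hP' _ (fst_mem_of_mem_stripPairs hPQ hx)
    have hL2 : ∀ x ∈ stripPairs P Q, d ≤ x.2 ∧ x.2 ≤ n :=
      fun x hx => hQ' _ (snd_mem_of_mem_stripPairs hPQ hx)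
    have hpw := pairwise_stripPairs hPQ
    have hpw' : (stripPairs P Q).Pairwise fun x y => cornerRow lam x.1 < cornerRow lam y.1 ∧
        cornerRow lam y.2 < cornerRow lam x.2 := by
      refine hpw.imp_of_mem fun {x y} hx hy h => ⟨?_, ?_⟩
      · have := hL1 x hx
        have := hL1 y hy
        exact rlt _ _ (by omega) h.1 (by omega)
      · have := hL2 x hx
        have := hL2 y hy
        exact rlt _ _ (by omega) h.2 (by omega)
    have hle : ∀ x ∈ stripPairs P Q, cornerRow lam x.1 ≤ cornerRow lam x.2 := by
      intro x hx
      have := hL1 x hx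
      have := hL2 x hx
      exact rle _ _ (by omega) (by omega) (by omega)
    have hadd : iteratedAdd lam P Q = (stripPairs P Q).foldr (fun x nu =>
        addStrip (cornerRow lam x.1, cornerCol lam x.1 - 1)
          (cornerRow lam x.2, lam.rowLen (cornerRow lam x.2)) nu) lam := by
      refine List.foldr_ext _ _ _ fun x hx nu => ?_
      have := hL2 x hx
      rw [addOp, mcol' x.2 (by omega) (by omega)]
    have hrem : iteratedRem lam P Q = (stripPairs P Q).foldr (fun x nu =>
        remStrip (cornerRow lam x.1 - 1, lam.rowLen (cornerRow lam x.1 - 1) - 1)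
          (cornerRow lam x.2 - 1, cornerCol lam (x.2 + 1)) nu) lam := by
      refine List.foldr_ext _ _ _ fun x hx nu => ?_
      have := hL1 x hx
      rw [remOp, mcol x.1 (by omega)]
    obtain ⟨-, -, π, hπs, -, hπ1, hπ2⟩ := exists_perm_beads_addStrips (k + 1) lam
      (fun x : ℕ × ℕ => cornerRow lam x.1) (fun x => cornerCol lam x.1 - 1)
      (fun x => cornerRow lam x.2) (stripPairs P Q) hpw' hle
      (fun x hx => by
        have := hL2 x hx
        exact Nat.lt_succ_of_le (rk _ (by omega) (by omega)))
      (fun x hx => by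
        have := hL1 x hx
        have := rdrop x.1 (by omega) (by omega)
        rw [mcol x.1 (by omega)]
        omega)
      (fun x hx _ => by
        have := hL1 x hx
        have := rdrop x.1 (by omega) (by omega)
        rw [mcol x.1 (by omega)]
        omega)
      (fun x hx h0 => by
        have := hL1 x hx
        have := rpos x.1 (by omega) (by omega)
        omega)
      (fun x hx => by
        have := hL2 x hx
        have := rpos x.2 (by omega) (by omega)
        have := rdrop x.2 (by omega) (by omega)
        omega) _ hadd
    obtain ⟨-, ρ, hρs, -, hρ1, hρ2⟩ := exists_perm_beads_remStrips k lam
      (fun x : ℕ × ℕ => cornerRow lam x.1 - 1) (fun x => cornerRow lam x.2 - 1)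
      (fun x => cornerCol lam (x.2 + 1)) (stripPairs P Q)
      (hpw'.imp_of_mem fun {x y} hx hy h => by
        have := hL1 x hx
        have := hL2 y hy
        have := rpos x.1 (by omega) (by omega)
        have := rpos y.2 (by omega) (by omega)
        omega)
      (fun x hx => by
        have := hle x hx
        omega)
      (fun x hx => by
        have := hL2 x hx
        have := rk x.2 (by omega) (by omega)
        have := rpos x.2 (by omega) (by omega)
        omega)
      (fun x hx => by
        have := hL2 x hx
        have := rdrop x.2 (by omega) (by omega)
        rw [mcol' x.2 (by omega) (by omega)]
        omega)
      (fun x hx => by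
        have := hL2 x hx
        rw [mcol' x.2 (by omega) (by omega), Nat.sub_add_cancel (rpos x.2 (by omega) (by omega))])
      _ hrem
    -- The removed strips lie one row higher than the added ones but span equally many rows, so the
    -- two sorting signs agree.
    have hs : Equiv.Perm.sign π = Equiv.Perm.sign ρ := by
      rw [hπs, hρs]
      congr 2
      refine List.map_congr_left fun x hx => ?_
      have := hL1 x hx
      have := hL2 x hx
      have := rpos x.1 (by omega) (by omega)
      have := rpos x.2 (by omega) (by omega)
      omega
    have hX : (Matrix.of fun i => if i ∈ Q.image ψ then M₂ (σ i) else M₁ i).det =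
        topMinor U (k + 1) (fun i => beads (k + 1) (iteratedAdd lam P Q) (π i)) := by
      rw [← det_topColumn_some U (c := fun i => if i ∈ Q.image ψ then c₂ (σ i) else c₁ i)]
      · congr 1
        ext i j
        by_cases hi : i ∈ Q.image ψ <;> simp only [hi, M₁, M₂, Matrix.of_apply, if_true, if_false]
      · intro i
        by_cases hi : i ∈ Q.image ψ
        · rw [if_pos hi]
          obtain ⟨q, hq, rfl⟩ := Finset.mem_image.1 hi
          obtain ⟨x, hx, rfl⟩ := exists_mem_stripPairs_snd hPQ hq
          have h1 := hL1 x hx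
          have h2 := hL2 x hx
          have h3 := rpos x.1 (by omega) (by omega)
          have h4 := rdrop x.1 (by omega) (by omega)
          have h5 := rk x.1 (by omega) (by omega)
          -- The incoming bead from row `r_p - 1` of `M₂` is `m_p + k - r_p`: exactly the bead of
          -- the top row of the added strip.
          rw [(hσ' x hx).2, hπ1 x hx _ (hψ _ (by omega) (by omega)), mcol x.1 (by omega)]
          simp only [c₂]
          rw [hφ x.1 (by omega) (by omega), if_pos (by omega)]
          congr 1
          omega
        · rw [if_neg hi, hπ2]
          intro x hx e
          have h2 := hL2 x hx
          refine hi (Finset.mem_image.2 ⟨x.2, snd_mem_of_mem_stripPairs hPQ hx, Fin.ext ?_⟩)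
          rw [hψ _ (by omega) (by omega), e]
    have hY : (Matrix.of fun i => if i ∈ P.image φ then M₁ (σ i) else M₂ i).det =
        topMinor U k (fun i => beads k (iteratedRem lam P Q) (ρ i)) := by
      rw [← det_topColumn_castSucc U (c := fun i => if i ∈ P.image φ then c₁ (σ i) else c₂ i)]
      · congr 1
        ext i j
        by_cases hi : i ∈ P.image φ <;> simp only [hi, M₁, M₂, Matrix.of_apply, if_true, if_false]
      · intro i
        by_cases hi : i.castSucc ∈ P.image φ
        · rw [if_pos hi]
          obtain ⟨p, hp, hpi⟩ := Finset.mem_image.1 hi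
          obtain ⟨x, hx, rfl⟩ := exists_mem_stripPairs_fst hPQ hp
          have h1 := hL1 x hx
          have h2 := hL2 x hx
          have h3 := rpos x.2 (by omega) (by omega)
          have h5 := rk x.2 (by omega) (by omega)
          have h6 : (i : ℕ) = cornerRow lam x.1 - 1 := by
            rw [← hφ _ (by omega) (by omega), hpi, Fin.val_castSucc]
          rw [← hpi, (hσ' x hx).1, hρ1 x hx _ h6, mcol' x.2 (by omega) (by omega)]
          simp only [c₁, beads]
          rw [hψ x.2 (by omega) (by omega)]
          congr 1
          omega
        · rw [if_neg hi, hρ2, hc₂]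
          intro x hx e
          have h1 := hL1 x hx
          refine hi (Finset.mem_image.2 ⟨x.1, fst_mem_of_mem_stripPairs hPQ hx, Fin.ext ?_⟩)
          rw [hφ _ (by omega) (by omega), Fin.val_castSucc, e]
      · rw [if_neg, hc₂']
        intro hi
        obtain ⟨p, hp, hpi⟩ := Finset.mem_image.1 hi
        have h1 := hP' p hp
        have h2 := congrArg Fin.val hpi
        rw [hφ p (by omega) (by omega), Fin.val_last] at h2
        have := rk p (by omega) (by omega)
        have := rpos p (by omega) (by omega)
        omega
    rw [exchangedProduct, hX, hY, topMinor_comp_perm, topMinor_comp_perm, hs, mul_mul_mul_comm,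
      ← Int.cast_mul, ← Units.val_mul, Int.units_mul_self]
    simp

/-! ### The conjugate form -/

theorem Exchanges.symm {ι : Type*} [Fintype ι] [DecidableEq ι] {σ : Equiv.Perm ι}
    {P Q : Finset ι} (h : Exchanges σ P Q) (hc : #P = #Q) : Exchanges σ Q P :=
  ⟨h.right, h.left, fun i hi hi' => h.fix i hi' hi, by rw [h.sign, hc]⟩

theorem card_corners_transpose (lam : YoungDiagram) : #(corners lam.transpose) = #(corners lam) := by
  refine Finset.card_bij (fun c _ => c.swap) ?_ ?_ ?_
  · rintro ⟨i, j⟩ h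
    simp only [corners, Finset.mem_filter, YoungDiagram.mem_cells,
      YoungDiagram.mem_transpose, Prod.swap] at h ⊢
    tauto
  · intro c _ c' _ h
    exact Prod.swap_injective h
  · rintro ⟨i, j⟩ h
    refine ⟨(j, i), ?_, rfl⟩
    simp only [corners, Finset.mem_filter, YoungDiagram.mem_cells,
      YoungDiagram.mem_transpose, Prod.swap] at h ⊢
    tauto

theorem iteratedAdd_transpose (lam : YoungDiagram) (P Q : Finset ℕ) :
    (iteratedAdd lam P Q).transpose = (stripPairs P Q).foldr (fun x nu =>
      addStrip (cornerCol lam (x.2 + 1), cornerRow lam x.2)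
        (cornerCol lam x.1 - 1, cornerRow lam x.1) nu) lam.transpose := by
  rw [iteratedAdd]
  symm
  apply List.foldr_hom
  intro x nu
  rw [addOp, addStrip_transpose]
  rfl

theorem iteratedRem_transpose (lam : YoungDiagram) (P Q : Finset ℕ) :
    (iteratedRem lam P Q).transpose = (stripPairs P Q).foldr (fun x nu =>
      remStrip (cornerCol lam (x.2 + 1), cornerRow lam x.2 - 1)
        (cornerCol lam x.1 - 1, cornerRow lam x.1 - 1) nu) lam.transpose := by
  rw [iteratedRem]
  symm
  apply List.foldr_hom
  intro x nu
  rw [remOp, remStrip_transpose]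
  rfl

/-- Lengthening the first `l` columns by one duplicates a row of length `l`; the hypothesis says
that such a row exists and that the last one ends at height `colLen (l - 1)`. The next lemma deletes
that row instead. -/
theorem rowLen_addColumn_transpose {lam : YoungDiagram} {l : ℕ} (hl : 0 < l)
    (h : lam.colLen l < lam.colLen (l - 1)) (i : ℕ) :
    (addColumn lam.transpose l).transpose.rowLen i =
      if i < lam.colLen (l - 1) then lam.rowLen i else lam.rowLen (i - 1) := by
  refine rowLen_eq_of_mem_iff fun j => ?_
  rw [YoungDiagram.mem_transpose, Prod.swap, YoungDiagram.mem_iff_lt_rowLen, rowLen_addColumn,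
    YoungDiagram.rowLen_transpose]
  simp only
  have h1 := lt_colLen_iff_lt_rowLen (lam := lam) (i := i) (j := j)
  have h2 := lt_colLen_iff_lt_rowLen (lam := lam) (i := i - 1) (j := j)
  rcases lt_or_ge j l with hj | hj
  · have := lam.colLen_anti j (l - 1) (by omega)
    split_ifs <;> omega
  · have := lam.colLen_anti l j hj
    split_ifs <;> omega

theorem rowLen_removeColumn_transpose {lam : YoungDiagram} {l : ℕ} (hl : 0 < l)
    (h : lam.colLen l < lam.colLen (l - 1)) (i : ℕ) :
    (removeColumn lam.transpose l).transpose.rowLen i =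
      if i + 1 < lam.colLen (l - 1) then lam.rowLen i else lam.rowLen (i + 1) := by
  refine rowLen_eq_of_mem_iff fun j => ?_
  rw [YoungDiagram.mem_transpose, Prod.swap, YoungDiagram.mem_iff_lt_rowLen,
    rowLen_removeColumn (by simpa using h), YoungDiagram.rowLen_transpose]
  simp only
  have h1 := lt_colLen_iff_lt_rowLen (lam := lam) (i := i) (j := j)
  have h2 := lt_colLen_iff_lt_rowLen (lam := lam) (i := i + 1) (j := j)
  rcases lt_or_ge j l with hj | hj
  · have := lam.colLen_anti j (l - 1) (by omega)
    split_ifs <;> omega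
  · have := lam.colLen_anti l j hj
    split_ifs <;> omega

/-- With the unit vector placed first, row `i > 0` of `M₁` carries `λ_{i-1} + k - i` and row `i` of
`M₂` carries `λ_i + k - i`. Rows with the same index therefore coincide unless the row length drops
there. The full swap duplicates a row in one diagram and deletes one in the other. -/
theorem topMinor_beads_mul_beads_transpose_eq {N k : ℕ} (lam : YoungDiagram)
    (hk : lam.colLen 0 ≤ k) (hN : lam.rowLen 0 + (k + 1) ≤ N) {n d : ℕ}
    (hn : #(corners lam) = n) (hd1 : 1 ≤ d) (hdn : d ≤ n) :
    topMinor (gaussUpper N) k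
          (beads k (removeColumn lam.transpose (cornerRow lam.transpose d)).transpose) *
        topMinor (gaussUpper N) (k + 1)
          (beads (k + 1) (addColumn lam.transpose (cornerRow lam.transpose d)).transpose) =
      ∑ P ∈ (Icc 1 d).powerset, ∑ Q ∈ (Icc d n).powerset, if #P = #Q then (-1) ^ #P *
        (topMinor (gaussUpper N) k (beads k (iteratedAdd lam.transpose P Q).transpose) *
          topMinor (gaussUpper N) (k + 1)
            (beads (k + 1) (iteratedRem lam.transpose P Q).transpose)) else 0 := by
  set U := gaussUpper N
  have hn' : #(corners lam.transpose) = n := by rw [card_corners_transpose, hn]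
  set r := cornerRow lam.transpose with hr
  have lcol := fun i j => lt_colLen_iff_lt_rowLen (lam := lam) (i := i) (j := j)
  have rpos : ∀ p, 1 ≤ p → p ≤ n → 0 < r p := fun p h h' =>
    (cornerRow_spec h (by rwa [hn'])).1
  have rdrop : ∀ p, 1 ≤ p → p ≤ n → lam.colLen (r p) < lam.colLen (r p - 1) := by
    intro p h h'
    have := (cornerRow_spec (lam := lam.transpose) h (by rwa [hn'])).2
    simpa using this
  have rlt : ∀ p q, 1 ≤ p → p < q → q ≤ n → r p < r q :=
    fun p q h h' h'' => cornerRow_lt h h' (by rwa [hn'])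
  have rle : ∀ p q, 1 ≤ p → p ≤ q → q ≤ n → r p ≤ r q :=
    fun p q h h' h'' => cornerRow_le h h' (by rwa [hn'])
  have rex : ∀ x, 0 < x → lam.colLen x < lam.colLen (x - 1) → ∃ p, 1 ≤ p ∧ p ≤ n ∧ r p = x := by
    intro x h h'
    rw [← hn']
    exact exists_cornerRow_eq h (by simpa using h')
  have mcol : ∀ p, p ≤ n → cornerCol lam.transpose p = lam.colLen (r p - 1) := by
    intro p h
    rw [cornerCol_eq (by rwa [hn']), YoungDiagram.rowLen_transpose]
  have mcol' : ∀ q, 1 ≤ q → q ≤ n → cornerCol lam.transpose (q + 1) = lam.colLen (r q) := by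
    intro q h h'
    rw [cornerCol_succ h (by rwa [hn']), YoungDiagram.rowLen_transpose]
  have mk : ∀ j, lam.colLen j ≤ k := fun j => (lam.colLen_anti 0 j (Nat.zero_le _)).trans hk
  have row1 : ∀ p, 1 ≤ p → p ≤ n → lam.rowLen (lam.colLen (r p - 1) - 1) = r p := by
    intro p h h'
    have h1 := rpos p h h'
    have h2 := rdrop p h h'
    have h3 := lcol (lam.colLen (r p - 1) - 1) (r p - 1)
    have h4 := lcol (lam.colLen (r p - 1) - 1) (r p)
    omega
  have row2 : ∀ p, 1 ≤ p → p ≤ n → lam.rowLen (lam.colLen (r p)) = r p := by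
    intro p h h'
    have h1 := rpos p h h'
    have h2 := rdrop p h h'
    have h3 := lcol (lam.colLen (r p)) (r p - 1)
    have h4 := lcol (lam.colLen (r p)) (r p)
    omega
  have mlt : ∀ p q, 1 ≤ p → p < q → q ≤ n → lam.colLen (r q) < lam.colLen (r p) := by
    intro p q h h' h''
    have h1 := rdrop q (by omega) h''
    have h2 := rlt p q h h' h''
    have h3 := lam.colLen_anti (r p) (r q - 1) (by omega)
    omega
  have mlt' : ∀ p q, 1 ≤ p → p < q → q ≤ n →
      lam.colLen (r q - 1) < lam.colLen (r p - 1) := by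
    intro p q h h' h''
    have h1 := rdrop p h (by omega)
    have h2 := rlt p q h h' h''
    have h3 := lam.colLen_anti (r p) (r q - 1) (by omega)
    omega
  have mle : ∀ p q, 1 ≤ p → p ≤ q → q ≤ n → lam.colLen (r q) < lam.colLen (r p - 1) := by
    intro p q h h' h''
    have h1 := rdrop p h (by omega)
    have h3 := lam.colLen_anti (r p) (r q) (rle p q h h' h'')
    omega
  set l := lam.colLen (r d - 1) with hl
  have hlpos : 0 < l := by
    have := rdrop d hd1 hdn
    omega
  have hlk : l ≤ k := mk _
  let c₁ : Fin (k + 1) → Option ℕ := fun i =>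
    if 0 < (i : ℕ) then some (lam.rowLen (i - 1) + (k - i)) else none
  let c₂ : Fin (k + 1) → Option ℕ := fun i => some (beads (k + 1) lam i)
  let M₁ : Matrix (Fin (k + 1)) (Fin (k + 1)) (RatField N) :=
    Matrix.of fun i => topColumn U (k + 1) (c₁ i)
  let M₂ : Matrix (Fin (k + 1)) (Fin (k + 1)) (RatField N) :=
    Matrix.of fun i => topColumn U (k + 1) (c₂ i)
  have hc₁ : ∀ i : Fin k, c₁ i.succ = some (beads k lam i) := by
    intro i
    have := i.2
    simp only [c₁, beads, Fin.val_succ, Nat.add_sub_cancel]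
    rw [if_pos (by omega)]
    congr 1
    omega
  have hc₁' : c₁ 0 = none := by simp [c₁]
  have hM₁ : M₁.det ≠ 0 := by
    rw [det_topColumn_succ U hc₁ hc₁']
    exact mul_ne_zero (pow_ne_zero _ (neg_ne_zero.2 one_ne_zero))
      (topMinor_beads_ne_zero (by omega))
  have hM₂ : M₂.det ≠ 0 := by
    rw [det_topColumn_some U (fun i => rfl)]
    exact topMinor_beads_ne_zero hN
  let T : Finset (Fin (k + 1)) := Finset.univ.filter fun i => (i : ℕ) < l
  have hT : ∀ i : Fin (k + 1), i ∈ T ↔ (i : ℕ) < l := by intro i; simp [T]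
  -- Conjugation reverses the order of the corners: the large indices `q ≥ d` now give rows in `T`,
  -- and `p ≤ d` rows outside `T`.
  let φ : ℕ → Fin (k + 1) := fun q => ⟨lam.colLen (r q), Nat.lt_succ_of_le (mk _)⟩
  let ψ : ℕ → Fin (k + 1) := fun p => ⟨lam.colLen (r p - 1), Nat.lt_succ_of_le (mk _)⟩
  have hφinj : Set.InjOn φ (Icc d n) := by
    intro p hp q hq e
    rw [Finset.mem_coe, Finset.mem_Icc] at hp hq
    have e' : lam.colLen (r p) = lam.colLen (r q) := congrArg Fin.val e
    rcases lt_trichotomy p q with h | h | h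
    · have := mlt p q (by omega) h (by omega)
      omega
    · exact h
    · have := mlt q p (by omega) h (by omega)
      omega
  have hψinj : Set.InjOn ψ (Icc 1 d) := by
    intro p hp q hq e
    rw [Finset.mem_coe, Finset.mem_Icc] at hp hq
    have e' : lam.colLen (r p - 1) = lam.colLen (r q - 1) := congrArg Fin.val e
    rcases lt_trichotomy p q with h | h | h
    · have := mlt' p q (by omega) h (by omega)
      omega
    · exact h
    · have := mlt' q p (by omega) h (by omega)
      omega
  have hφT : ∀ q ∈ Icc d n, φ q ∈ T := by
    intro q hq
    rw [Finset.mem_Icc] at hq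
    exact (hT _).2 (mle d q hd1 hq.1 hq.2)
  have hψT : ∀ p ∈ Icc 1 d, ψ p ∉ T := by
    intro p hp h
    rw [Finset.mem_Icc] at hp
    have h1 : lam.colLen (r p - 1) < l := (hT _).1 h
    have h2 := rle p d hp.1 hp.2 hdn
    have h3 := lam.colLen_anti (r p - 1) (r d - 1) (by omega)
    omega
  have main := exchange_identity hM₁ hM₂ T (Icc d n) (Icc 1 d) φ ψ hφinj hψinj hφT hψT ?_ ?_
    (fun Q P => (-1) ^ k * (topMinor U k (beads k (iteratedAdd lam.transpose P Q).transpose) *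
          topMinor U (k + 1) (beads (k + 1) (iteratedRem lam.transpose P Q).transpose))) ?_
  · have h1 : (rowPiecewise T M₂ M₁).det = topMinor U (k + 1)
        (beads (k + 1) (addColumn lam.transpose (r d)).transpose) := by
      rw [← det_topColumn_some U (c := fun i => if i ∈ T then c₂ i else c₁ i)]
      · congr 1
        ext i j
        by_cases hi : i ∈ T <;> simp [rowPiecewise, hi, M₁, M₂]
      · intro i
        rw [beads, rowLen_addColumn_transpose (rpos d hd1 hdn) (rdrop d hd1 hdn)]
        by_cases hi : (i : ℕ) < l
        · rw [if_pos ((hT i).2 hi), if_pos hi]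
          rfl
        · rw [if_neg (fun h => hi ((hT i).1 h)), if_neg hi]
          simp only [c₁]
          rw [if_pos (by omega)]
          congr 1
    have h2 : (rowPiecewise T M₁ M₂).det = (-1) ^ k * topMinor U k
        (beads k (removeColumn lam.transpose (r d)).transpose) := by
      rw [← det_topColumn_succ U (c := fun i => if i ∈ T then c₁ i else c₂ i)]
      · congr 1
        ext i j
        by_cases hi : i ∈ T <;> simp [rowPiecewise, hi, M₁, M₂]
      · intro i
        rw [beads, rowLen_removeColumn_transpose (rpos d hd1 hdn) (rdrop d hd1 hdn)]
        by_cases hi : (i : ℕ) + 1 < l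
        · rw [if_pos ((hT _).2 hi), if_pos hi, hc₁, beads]
        · rw [if_neg (fun h => hi ((hT _).1 h)), if_neg hi]
          simp only [c₂, beads, Fin.val_succ]
          congr 1
          omega
      · rw [if_pos ((hT _).2 hlpos), hc₁']
    rw [h1, h2] at main
    -- Every product contains exactly one determinant with the unit vector in first place, so the
    -- factor `(-1) ^ k` is common and cancels.
    have hk0 : ((-1) ^ k : RatField N) ≠ 0 := pow_ne_zero _ (neg_ne_zero.2 one_ne_zero)
    apply mul_left_cancel₀ hk0
    rw [Finset.sum_comm, Finset.mul_sum]
    refine Eq.trans (by ring) (main.trans ?_)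
    refine Finset.sum_congr rfl fun Q _ => ?_
    rw [Finset.mul_sum]
    refine Finset.sum_congr rfl fun P _ => ?_
    by_cases h : #P = #Q
    · rw [if_pos h, if_pos h.symm, h]
      ring
    · rw [if_neg h, if_neg (fun h' => h h'.symm), mul_zero]
  · intro i hi hno
    rw [hT] at hi
    refine ⟨i, (hT i).2 hi, ?_⟩
    -- Row `0` of `M₁` is the unit vector and matches no bead, but it is always an exchangeable row:
    -- it corresponds to `q = n`, because `m_{n+1} = 0`.
    have h0 : 0 < (i : ℕ) := by
      rw [Nat.pos_iff_ne_zero]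
      intro h0
      refine hno n (Finset.mem_Icc.2 ⟨hdn, le_rfl⟩) (Fin.ext ?_)
      have h1 := mcol' n (by omega) le_rfl
      rw [cornerCol, if_neg (by omega)] at h1
      simp only [φ]
      omega
    have h1 : lam.rowLen (i - 1) = lam.rowLen i := by
      by_contra hne
      have h2 := lam.rowLen_anti (i - 1) i (by omega)
      have a1 := lcol i (r d - 1)
      have a2 := lcol (i - 1) (lam.rowLen i)
      have a3 := lcol i (lam.rowLen i)
      have a4 := lcol i (lam.rowLen i - 1)
      have a5 := rpos d hd1 hdn
      obtain ⟨q, hq1, hq2, hq⟩ := rex (lam.rowLen i) (by omega) (by omega)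
      have hqd : d ≤ q := by
        by_contra hc
        have := rlt q d hq1 (by omega) hdn
        omega
      refine hno q (Finset.mem_Icc.2 ⟨hqd, hq2⟩) (Fin.ext ?_)
      simp only [φ, hq]
      omega
    have : c₂ i = c₁ i := by
      simp only [c₁, c₂, beads]
      rw [if_pos h0, h1]
      congr 1
    exact congrArg (topColumn U (k + 1)) this
  · intro i hi hno
    rw [hT] at hi
    refine ⟨i, fun h => hi ((hT i).1 h), ?_⟩
    have h1 : lam.rowLen (i - 1) = lam.rowLen i := by
      by_contra hne
      have h2 := lam.rowLen_anti (i - 1) i (by omega)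
      have a1 := lcol i (lam.rowLen (i - 1) - 1)
      have a2 := lcol (i - 1) (lam.rowLen (i - 1) - 1)
      have a3 := lcol (i - 1) (lam.rowLen (i - 1))
      obtain ⟨p, hp1, hp2, hp⟩ := rex (lam.rowLen (i - 1)) (by omega) (by omega)
      have hpd : p ≤ d := by
        by_contra hc
        have b1 := rlt d p hd1 (by omega) hp2
        have b2 := lam.colLen_anti (r d) (lam.rowLen (i - 1) - 1) (by omega)
        have b3 : lam.colLen (r d) < l := rdrop d hd1 hdn
        omega
      refine hno p (Finset.mem_Icc.2 ⟨hp1, hpd⟩) (Fin.ext ?_)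
      simp only [ψ, hp]
      omega
    have : c₁ i = c₂ i := by
      simp only [c₁, c₂, beads]
      rw [if_pos (by omega), h1]
      congr 1
    exact congrArg (topColumn U (k + 1)) this
  · intro Q hQ P hP hQP
    have hPQ : #P = #Q := hQP.symm
    have hP' : ∀ p ∈ P, 1 ≤ p ∧ p ≤ d := fun p hp => Finset.mem_Icc.1 (hP hp)
    have hQ' : ∀ q ∈ Q, d ≤ q ∧ q ≤ n := fun q hq => Finset.mem_Icc.1 (hQ hq)
    have hψinj' : Set.InjOn ψ P := hψinj.mono (by exact_mod_cast hP)
    have hφinj' : Set.InjOn φ Q := hφinj.mono (by exact_mod_cast hQ)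
    obtain ⟨σ, hσ, hσ'⟩ := exists_exchanges_stripPairs hPQ hψinj' hφinj'
      (fun p hp q hq e => hψT p (hP hp) (e ▸ hφT q (hQ hq)))
    refine ⟨σ, hσ.symm (by
      rw [Finset.card_image_of_injOn hψinj', Finset.card_image_of_injOn hφinj', hPQ]), ?_⟩
    have hL1 : ∀ x ∈ stripPairs P Q, 1 ≤ x.1 ∧ x.1 ≤ d :=
      fun x hx => hP' _ (fst_mem_of_mem_stripPairs hPQ hx)
    have hL2 : ∀ x ∈ stripPairs P Q, d ≤ x.2 ∧ x.2 ≤ n :=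
      fun x hx => hQ' _ (snd_mem_of_mem_stripPairs hPQ hx)
    have hpw : (stripPairs P Q).Pairwise fun x y => lam.colLen (r x.2) < lam.colLen (r y.2) ∧
        lam.colLen (r y.1 - 1) - 1 < lam.colLen (r x.1 - 1) - 1 := by
      refine (pairwise_stripPairs hPQ).imp_of_mem fun {x y} hx hy h => ⟨?_, ?_⟩
      · have := hL2 x hx
        have := hL2 y hy
        exact mlt _ _ (by omega) h.2 (by omega)
      · have := hL1 x hx
        have := hL1 y hy
        have := mlt' _ _ (by omega) h.1 (by omega)
        have := rdrop y.1 (by omega) (by omega)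
        omega
    have hle : ∀ x ∈ stripPairs P Q, lam.colLen (r x.2) ≤ lam.colLen (r x.1 - 1) - 1 := by
      intro x hx
      have := hL1 x hx
      have := hL2 x hx
      have := mle x.1 x.2 (by omega) (by omega) (by omega)
      omega
    have hadd : (iteratedAdd lam.transpose P Q).transpose = (stripPairs P Q).foldr (fun x nu =>
        addStrip (lam.colLen (r x.2), r x.2)
          (lam.colLen (r x.1 - 1) - 1, lam.rowLen (lam.colLen (r x.1 - 1) - 1)) nu) lam := by
      rw [iteratedAdd_transpose, YoungDiagram.transpose_transpose]
      refine List.foldr_ext _ _ _ fun x hx nu => ?_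
      have := hL1 x hx
      have := hL2 x hx
      rw [mcol' x.2 (by omega) (by omega), mcol x.1 (by omega), row1 x.1 (by omega) (by omega)]
    have hrem : (iteratedRem lam.transpose P Q).transpose = (stripPairs P Q).foldr (fun x nu =>
        remStrip (lam.colLen (r x.2), lam.rowLen (lam.colLen (r x.2)) - 1)
          (lam.colLen (r x.1 - 1) - 1, r x.1 - 1) nu) lam := by
      rw [iteratedRem_transpose, YoungDiagram.transpose_transpose]
      refine List.foldr_ext _ _ _ fun x hx nu => ?_
      have := hL1 x hx
      have := hL2 x hx
      rw [mcol' x.2 (by omega) (by omega), mcol x.1 (by omega), row2 x.2 (by omega) (by omega)]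
    obtain ⟨-, -, π, hπs, -, hπ1, hπ2⟩ := exists_perm_beads_addStrips k lam
      (fun x : ℕ × ℕ => lam.colLen (r x.2)) (fun x => r x.2)
      (fun x => lam.colLen (r x.1 - 1) - 1) (stripPairs P Q) hpw hle
      (fun x hx => by
        have := hL1 x hx
        have := rdrop x.1 (by omega) (by omega)
        have := mk (r x.1 - 1)
        omega)
      (fun x hx => by
        have := hL2 x hx
        exact (row2 x.2 (by omega) (by omega)).le)
      (fun x hx h0 => by
        have := lcol (lam.colLen (r x.2) - 1) (r x.2)
        omega)
      (fun x hx h0 => by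
        have := hL2 x hx
        have := rpos x.2 (by omega) (by omega)
        have := row2 x.2 (by omega) (by omega)
        rw [h0] at this
        omega)
      (fun x hx => by
        have := hL1 x hx
        have := rpos x.1 (by omega) (by omega)
        rw [row1 x.1 (by omega) (by omega)]
        omega) _ hadd
    obtain ⟨-, ρ, hρs, -, hρ1, hρ2⟩ := exists_perm_beads_remStrips (k + 1) lam
      (fun x : ℕ × ℕ => lam.colLen (r x.2)) (fun x => lam.colLen (r x.1 - 1) - 1)
      (fun x => r x.1 - 1) (stripPairs P Q) hpw hle
      (fun x hx => by
        have := mk (r x.1 - 1)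
        omega)
      (fun x hx => by
        have := hL1 x hx
        have := rpos x.1 (by omega) (by omega)
        rw [row1 x.1 (by omega) (by omega)]
        omega)
      (fun x hx => by
        have := hL1 x hx
        have := rdrop x.1 (by omega) (by omega)
        have := lcol (lam.colLen (r x.1 - 1)) (r x.1 - 1)
        rw [Nat.sub_add_cancel (by omega)]
        omega)
      _ hrem
    have hX : (Matrix.of fun i => if i ∈ P.image ψ then M₂ (σ i) else M₁ i).det = (-1) ^ k *
        topMinor U k (fun i => beads k (iteratedAdd lam.transpose P Q).transpose (π i)) := by
      rw [← det_topColumn_succ U (c := fun i => if i ∈ P.image ψ then c₂ (σ i) else c₁ i)]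
      · congr 1
        ext i j
        by_cases hi : i ∈ P.image ψ <;> simp only [hi, M₁, M₂, Matrix.of_apply, if_true, if_false]
      · intro i
        by_cases hi : i.succ ∈ P.image ψ
        · rw [if_pos hi]
          obtain ⟨p, hp, hpi⟩ := Finset.mem_image.1 hi
          obtain ⟨x, hx, rfl⟩ := exists_mem_stripPairs_fst hPQ hp
          have h1 := hL1 x hx
          have h2 := hL2 x hx
          have h3 := rdrop x.2 (by omega) (by omega)
          have h4 := mk (r x.2 - 1)
          have h5 : lam.colLen (r x.1 - 1) = i + 1 := congrArg Fin.val hpi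
          have h6 := row2 x.2 (by omega) (by omega)
          rw [← hpi, (hσ' x hx).1, hπ1 x hx _ (by omega)]
          simp only [c₂, φ, beads, h6]
          congr 1
          omega
        · rw [if_neg hi, hπ2, hc₁]
          intro x hx e
          have h1 := hL1 x hx
          have h2 := rdrop x.1 (by omega) (by omega)
          refine hi (Finset.mem_image.2 ⟨x.1, fst_mem_of_mem_stripPairs hPQ hx, Fin.ext ?_⟩)
          simp only [ψ, Fin.val_succ]
          omega
      · rw [if_neg, hc₁']
        intro hi
        obtain ⟨p, hp, hpi⟩ := Finset.mem_image.1 hi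
        have h1 := hP' p hp
        have h2 : lam.colLen (r p - 1) = 0 := congrArg Fin.val hpi
        have := rdrop p (by omega) (by omega)
        omega
    have hY : (Matrix.of fun i => if i ∈ Q.image φ then M₁ (σ i) else M₂ i).det =
        topMinor U (k + 1)
          (fun i => beads (k + 1) (iteratedRem lam.transpose P Q).transpose (ρ i)) := by
      rw [← det_topColumn_some U (c := fun i => if i ∈ Q.image φ then c₁ (σ i) else c₂ i)]
      · congr 1
        ext i j
        by_cases hi : i ∈ Q.image φ <;> simp only [hi, M₁, M₂, Matrix.of_apply, if_true, if_false]
      · intro i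
        by_cases hi : i ∈ Q.image φ
        · rw [if_pos hi]
          obtain ⟨q, hq, rfl⟩ := Finset.mem_image.1 hi
          obtain ⟨x, hx, rfl⟩ := exists_mem_stripPairs_snd hPQ hq
          have h1 := hL1 x hx
          have h2 := hL2 x hx
          have h3 := rdrop x.1 (by omega) (by omega)
          have h4 := mk (r x.1 - 1)
          have h5 := rpos x.1 (by omega) (by omega)
          rw [(hσ' x hx).2, hρ1 x hx _ rfl]
          simp only [c₁, ψ]
          rw [if_pos (by omega), row1 x.1 (by omega) (by omega)]
          congr 1
          omega
        · rw [if_neg hi, hρ2]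
          intro x hx e
          exact hi (Finset.mem_image.2 ⟨x.2, snd_mem_of_mem_stripPairs hPQ hx, Fin.ext e.symm⟩)
    rw [exchangedProduct, hX, hY, topMinor_comp_perm, topMinor_comp_perm, hπs, hρs, mul_assoc,
      mul_mul_mul_comm, ← Int.cast_mul, ← Units.val_mul, Int.units_mul_self]
    simp

/-! ### Assembling the theorem -/

theorem iteratedAdd_empty (lam : YoungDiagram) : iteratedAdd lam ∅ ∅ = lam := by
  simp [iteratedAdd, stripPairs]

theorem iteratedRem_empty (lam : YoungDiagram) : iteratedRem lam ∅ ∅ = lam := by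
  simp [iteratedRem, stripPairs]

theorem ninthSchur_mul_ninthSchur (N r r' : ℕ) (nu nu' : YoungDiagram) :
    ninthSchur N r nu * ninthSchur N r' nu' =
      (((Equiv.Perm.sign (Fin.revPerm (n := r)) : ℤ) : RatField N) *
        ((Equiv.Perm.sign (Fin.revPerm (n := r')) : ℤ) : RatField N)) *
      (topMinor (gaussUpper N) r (beads r nu) * topMinor (gaussUpper N) r' (beads r' nu')) := by
  rw [ninthSchur_eq_topMinor, ninthSchur_eq_topMinor, mul_mul_mul_comm]

theorem eq_add_mul_of_eq_sub {K : Type*} [Field K] {a b c s s' e : K} (h : c = a - s)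
    (hs : s' = e * s) (hb : b = e * c) : e * a = b + s' := by
  rw [hb, hs, h]; ring

theorem mainTheorem1 (r s : ℕ) (lam : YoungDiagram)
    (hr : lam.colLen 0 ≤ r) (hs : lam.rowLen 0 ≤ s)
    (n d : ℕ) (hn : #(corners lam) = n) (hd1 : 1 ≤ d) (hdn : d ≤ n) :
    (lam.colLen 0 < r → ∀ l : ℕ, l = shortestColumn lam d →
      ninthSchur (r + s) r lam * ninthSchur (r + s) (r - 1) lam =
        ninthSchur (r + s) r (removeColumn lam l) *
            ninthSchur (r + s) (r - 1) (addColumn lam l) +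
          ∑ t ∈ Icc 1 (min d (n - d + 1)), (-1) ^ (t - 1) *
            ∑ P ∈ powersetCard t (Icc 1 d), ∑ Q ∈ powersetCard t (Icc d n),
              ninthSchur (r + s) r (iteratedAdd lam P Q) *
                ninthSchur (r + s) (r - 1) (iteratedRem lam P Q)) ∧
    (lam.rowLen 0 < s → ∀ l : ℕ, l = shortestRow lam d →
      ninthSchur (r + s) r lam * ninthSchur (r + s) (r + 1) lam =
        ninthSchur (r + s) r (removeColumn lam.transpose l).transpose *
            ninthSchur (r + s) (r + 1) (addColumn lam.transpose l).transpose +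
          ∑ t ∈ Icc 1 (min d (n - d + 1)), (-1) ^ (t - 1) *
            ∑ P ∈ powersetCard t (Icc 1 d), ∑ Q ∈ powersetCard t (Icc d n),
              ninthSchur (r + s) r (iteratedAdd lam.transpose P Q).transpose *
                ninthSchur (r + s) (r + 1) (iteratedRem lam.transpose P Q).transpose) := by
  constructor
  · rintro h l rfl
    obtain ⟨k, rfl⟩ : ∃ k, r = k + 1 := ⟨r - 1, by omega⟩
    have key := topMinor_beads_mul_beads_eq (N := k + 1 + s) (k := k) lam (by omega) (by omega)
      hn hd1 hdn
    rw [sum_powerset_eq_sub hd1 (fun P Q => topMinor _ (k + 1) (beads (k + 1) (iteratedAdd lam P Q)) *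
      topMinor _ k (beads k (iteratedRem lam P Q)))] at key
    simp only [iteratedAdd_empty, iteratedRem_empty] at key
    -- All products of Schur functions carry the same product of two reversal signs, so the identity
    -- reduces to the one between minors.
    simp only [Nat.add_sub_cancel, shortestColumn_eq, ninthSchur_mul_ninthSchur]
    refine eq_add_mul_of_eq_sub key ?_ rfl
    simp only [Finset.mul_sum]
    exact Finset.sum_congr rfl fun t _ => Finset.sum_congr rfl fun P _ =>
      Finset.sum_congr rfl fun Q _ => mul_left_comm _ _ _
  · rintro h l rfl
    have key := topMinor_beads_mul_beads_transpose_eq (N := r + s) (k := r) lam hr (by omega)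
      hn hd1 hdn
    rw [sum_powerset_eq_sub hd1 (fun P Q =>
      topMinor _ r (beads r (iteratedAdd lam.transpose P Q).transpose) *
        topMinor _ (r + 1) (beads (r + 1) (iteratedRem lam.transpose P Q).transpose))] at key
    simp only [iteratedAdd_empty, iteratedRem_empty, YoungDiagram.transpose_transpose] at key
    simp only [shortestRow_eq, ninthSchur_mul_ninthSchur]
    refine eq_add_mul_of_eq_sub key ?_ rfl
    simp only [Finset.mul_sum]
    exact Finset.sum_congr rfl fun t _ => Finset.sum_congr rfl fun P _ =>
      Finset.sum_congr rfl fun Q _ => mul_left_comm _ _ _
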